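/- Notation. Let $\mathcal H(S^1)$ be the space of functions on the unit circle that extend holomorphically to a neighbourhood of it, with Laurent expansions $f=\sum_{k\in\mathbb Z} f_kz^k$ and projections $f_{\ge1}=\sum_{k\ge1}f_kz^k$, $f_{\le0}=\sum_{k\le0}f_kz^k$. Points of the 2D Toda Dubrovin--Frobenius manifold are written as triples $(w(z),v,u)\in\mathcal H(S^1)\oplus\mathbb C^2$, with superpotentials $\lambda=w_{\le0}+z-v-e^uz^{-1}$, $\bar\lambda=w_{\ge1}-z+v+e^uz^{-1}$ (so $w=\lambda+\bar\lambda$), and tangent vectors as triples $\hat X=(X(z),X_v,X_u)\in\mathcal H(S^1)\oplus\mathbb C^2$. For $\sigma\in\mathbb C$ put $\lambda_\sigma=\sigma\bar\lambda+(\sigma-1)\lambda$, so that $\langle d\lambda_\sigma(z),\hat X\rangle=\sigma\big(X_{\ge1}(z)+X_v+e^uX_uz^{-1}\big)+(\sigma-1)\big(X_{\le0}(z)-X_v-e^uX_uz^{-1}\big)$, and let $\sigma(z)=\lambda'(z)/(\lambda'(z)+\bar\lambda'(z))$ for $|z|=1$. The metric is $$\eta(\hat X,\hat Y)=\frac1{2\pi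 i}\oint_{|z|=1}\frac{X(z)Y(z)}{z^2w'(z)}\,dz+X_vY_u+X_uY_v .$$ A cotangent vector is a linear functional on the tangent space; it is representable if it equals $\eta(\hat Z,\cdot)$ for some tangent vector $\hat Z$. A weak cotangent vector is a linear functional on the space $\mathbb C[z,z^{-1}]\oplus\mathbb C^2$ of test vectors; its coefficients are its values on $e_m=(z^m,0,0)$ ($m\in\mathbb Z$), $e_v=(0,1,0)$, $e_u=(0,0,1)$. Fix the special point $(w(z),v,u)=(z,v,u)$ with $v,u\in\mathbb C$, a point $p=e^{i\alpha}$ of the unit circle with a chosen argument $\alpha\in\mathbb R$, and $\zeta=e^{\ell}$ on the universal covering of $\mathbb C^*$, with $\zeta^{1/2}=e^{\ell/2}$. Let $\sigma=\sigma(p)=1+e^u/p^2$ and $u_p=\lambda_{\sigma(p)}(p)=v+2e^u/p$. Integral solution. Let $y_\sigma(\zeta)=\frac{\zeta^{-1/2}}{2\pi i}\oint_{|z|=1}e^{\zeta\lambda_\sigma(z)}\frac{dz}{z}$ and $$\langle dy_\sigma(\zeta),\hat X\rangle=\frac{\zeta^{1/2}}{2\pi i}\oint_{|z|=1}e^{\zeta\lambda_\sigma(z)}\langle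 d\lambda_\sigma(z),\hat X\rangle\frac{dz}{z}.$$ Resummed weak functionals. Let $\varphi^m_p(\zeta)=\sum_{k\ge0}\frac1{\Gamma(\frac12-k)}\binom{m+k-\frac12}{2k}\big(\frac p{\zeta e^u}\big)^k$, and let $s(\varphi_p^m)$ be its Borel resummation: the analytic continuation to the universal covering of $\mathbb C^*$ of $\zeta\int_{e^{i\theta}\mathbb R_+}\widehat\varphi{}_p^m(\chi)e^{-\zeta\chi}d\chi$, defined for $|\arg\zeta+\theta|<\frac\pi2$, where $\widehat\varphi{}^m_p$ is the Borel transform (the sum of the series obtained by $\zeta^{-k}\mapsto\chi^k/k!$, continued analytically along the ray) and $\theta=\operatorname{Im}u-\alpha-\pi$ is the direction opposite to its singularity $4e^u/p$. With $\sqrt{p/e^u}=e^{(i\alpha-u)/2}$ and $\sqrt{e^u/p}$ its inverse, the weak cotangent vector $ds_p(\zeta)$ is defined by the coefficients $$\langle ds_p,e_m\rangle=\tfrac12e^{\zeta u_p}\sigma(p)\,p^m\sqrt{\tfrac p{e^u}}\,s(\varphi^m_p)(\zeta)\ (m\ge1),\qquad \langle ds_p,e_m\rangle=\tfrac12e^{\zeta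 u_p}(\sigma(p)-1)\,p^m\sqrt{\tfrac p{e^u}}\,s(\varphi^m_p)(\zeta)\ (m\le0),$$ $$\langle ds_p,e_v\rangle=\tfrac12e^{\zeta u_p}\sqrt{\tfrac p{e^u}}\,s(\varphi^0_p)(\zeta),\qquad \langle ds_p,e_u\rangle=\tfrac12e^{\zeta u_p}\sqrt{\tfrac{e^u}p}\,s(\varphi^{-1}_p)(\zeta).$$ It is multivalued in $p$; $ds_{-p}$ denotes the functional for $-p=e^{i(\alpha-\pi)}$, with argument $\alpha-\pi$. Proposition. The functional $dy_\sigma(\zeta)$ is the differential of $y_\sigma(\zeta)$ at the special point, and its coefficients are given by the modified Bessel functions of the first kind $I_m(x)=\sum_{k\ge0}\frac{(x/2)^{2k+m}}{\Gamma(k+m+1)\,k!}$: $$\langle dy_\sigma,e_m\rangle=\Big(\frac{e^u}{p^2}+1\Big)\zeta^{\frac12}e^{\zeta v}p^mI_m\Big(\zeta\frac{2e^u}p\Big)\ (m\ge1),\qquad \langle dy_\sigma,e_m\rangle=\frac{e^u}{p^2}\zeta^{\frac12}e^{\zeta v}p^mI_m\Big(\zeta\frac{2e^u}p\Big)\ (m\le0),$$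 $$\langle dy_\sigma,e_v\rangle=\zeta^{\frac12}e^{\zeta v}I_0\Big(\zeta\frac{2e^u}p\Big),\qquad \langle dy_\sigma,e_u\rangle=\frac{e^u}p\zeta^{\frac12}e^{\zeta v}I_1\Big(\zeta\frac{2e^u}p\Big).$$ The Borel resummations $s(\varphi_p^m)$ and $s(\varphi_{-p}^m)$ exist for all $m\in\mathbb Z$, and on test vectors $$dy_\sigma(\zeta)=ds_p(\zeta)-ds_{-p}(\zeta).$$ Moreover $dy_\sigma(\zeta)$, and hence the extension of $ds_p(\zeta)-ds_{-p}(\zeta)$ that it provides, is a representable cotangent vector. -/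

import Mathlib

open Complex MeasureTheory Filter Topology
open scoped Real

noncomputable section

namespace TodaDF

/-! ### Holomorphic functions on the unit circle and their Laurent projections -/

/-- The space `ℋ(S¹)`: functions on the unit circle which extend holomorphically to a
neighbourhood of it. -/
def holoCircle : Submodule ℂ (Metric.sphere (0 : ℂ) 1 → ℂ) where
  carrier := {f | ∃ F : ℂ → ℂ, AnalyticOnNhd ℂ F (Metric.sphere 0 1) ∧
    ∀ z : Metric.sphere (0 : ℂ) 1, F z = f z}
  zero_mem' := ⟨fun _ => 0, fun _ _ => analyticAt_const, fun _ => rfl⟩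
  add_mem' := by
    rintro f g ⟨F, hF, hFf⟩ ⟨G, hG, hGg⟩
    exact ⟨fun z => F z + G z, fun z hz => (hF z hz).add (hG z hz),
      fun z => by simp [hFf, hGg]⟩
  smul_mem' := by
    rintro c f ⟨F, hF, hFf⟩
    exact ⟨fun z => c * F z, fun z hz => analyticAt_const.mul (hF z hz),
      fun z => by simp [hFf]⟩

/-- The space `ℋ(S¹)`, as a type. -/
abbrev HoloCircle : Type := holoCircle

namespace HoloCircle

/-- A holomorphic extension of `f` to a neighbourhood of the circle. Its values on the circle
(the only ones used below) are those of `f`. -/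
def extension (f : HoloCircle) : ℂ → ℂ := f.2.choose

theorem extension_analytic (f : HoloCircle) : AnalyticOnNhd ℂ f.extension (Metric.sphere 0 1) :=
  f.2.choose_spec.1

theorem extension_eq (f : HoloCircle) (z : Metric.sphere (0 : ℂ) 1) : f.extension z = f.1 z :=
  f.2.choose_spec.2 z

theorem extension_add (f g : HoloCircle) {z : ℂ} (hz : z ∈ Metric.sphere (0 : ℂ) 1) :
    (f + g).extension z = f.extension z + g.extension z := by
  have h1 := extension_eq (f + g) ⟨z, hz⟩
  have h2 := extension_eq f ⟨z, hz⟩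
  have h3 := extension_eq g ⟨z, hz⟩
  simp only [Submodule.coe_add, Pi.add_apply] at h1 h2 h3
  rw [h1, h2, h3]

theorem extension_smul (c : ℂ) (f : HoloCircle) {z : ℂ} (hz : z ∈ Metric.sphere (0 : ℂ) 1) :
    (c • f).extension z = c * f.extension z := by
  have h1 := extension_eq (c • f) ⟨z, hz⟩
  have h2 := extension_eq f ⟨z, hz⟩
  simp only [Submodule.coe_smul, Pi.smul_apply, smul_eq_mul] at h1 h2
  rw [h1, h2]

/-- The Laurent coefficient `f_k = (1 / 2πi) ∮ f(z) z⁻ᵏ dz / z`. -/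
def coeff (f : HoloCircle) (k : ℤ) : ℂ :=
  (2 * π * I)⁻¹ * ∮ z in C(0, 1), f.extension z * z ^ (-k) * z⁻¹

/-- The projection `f_{≥ 1}(z) = ∑_{k ≥ 1} f_k zᵏ`. -/
def geOne (f : HoloCircle) (z : ℂ) : ℂ := ∑' k : ℕ, f.coeff (k + 1) * z ^ (k + 1)

/-- The projection `f_{≤ 0}(z) = ∑_{k ≤ 0} f_k zᵏ`. -/
def leZero (f : HoloCircle) (z : ℂ) : ℂ := ∑' k : ℕ, f.coeff (-k) * z⁻¹ ^ k

theorem sphere_ne_zero {z : ℂ} (hz : z ∈ Metric.sphere (0 : ℂ) 1) : z ≠ 0 := by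
  rintro rfl
  simp at hz

theorem circleIntegrable_coeff (f : HoloCircle) (k : ℤ) :
    CircleIntegrable (fun z => f.extension z * z ^ (-k) * z⁻¹) 0 1 := by
  refine ContinuousOn.circleIntegrable zero_le_one ?_
  have hz : ∀ z ∈ Metric.sphere (0 : ℂ) 1, z ≠ 0 := fun z => sphere_ne_zero
  exact (f.extension_analytic.continuousOn.mul
    (continuousOn_id.zpow₀ (-k) fun z h => Or.inl (hz z h))).mul
    (continuousOn_id.inv₀ hz)

theorem coeff_add (f g : HoloCircle) (k : ℤ) : (f + g).coeff k = f.coeff k + g.coeff k := by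
  unfold coeff
  rw [← mul_add, ← circleIntegral.integral_add (circleIntegrable_coeff f k)
    (circleIntegrable_coeff g k)]
  congr 1
  refine circleIntegral.integral_congr zero_le_one fun z hz => ?_
  simp only [extension_add f g hz]
  ring

theorem coeff_smul (c : ℂ) (f : HoloCircle) (k : ℤ) : (c • f).coeff k = c * f.coeff k := by
  unfold coeff
  rw [mul_left_comm, ← circleIntegral.integral_const_mul c]
  congr 1
  refine circleIntegral.integral_congr zero_le_one fun z hz => ?_
  simp only [extension_smul c f hz]
  ring

/-- Laurent coefficients can be estimated on any circle close to the unit circle. -/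
theorem exists_coeff_le (f : HoloCircle) : ∃ δ : ℝ, 0 < δ ∧ δ < 1 ∧ ∃ M : ℝ, 0 ≤ M ∧ ∀ ρ : ℝ,
    1 - δ ≤ ρ → ρ ≤ 1 + δ → ∀ k : ℤ, ‖f.coeff k‖ ≤ M * ρ ^ (-k) := by
  have hU : IsOpen {z | AnalyticAt ℂ f.extension z} := isOpen_analyticAt ℂ f.extension
  obtain ⟨ε, hε, hsub⟩ := (isCompact_sphere (0 : ℂ) 1).exists_cthickening_subset_open hU
    f.extension_analytic
  set δ := min ε (1 / 2) with hδ
  have hδ0 : 0 < δ := lt_min hε (by norm_num)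
  have hδ1 : δ < 1 := (min_le_right _ _).trans_lt (by norm_num)
  have han : ∀ z : ℂ, 1 - δ ≤ ‖z‖ → ‖z‖ ≤ 1 + δ → AnalyticAt ℂ f.extension z := by
    intro z h1 h2
    have hz : 0 < ‖z‖ := by linarith
    have hz' : (‖z‖ : ℂ) ≠ 0 := by exact_mod_cast hz.ne'
    refine hsub (Metric.mem_cthickening_of_dist_le z (z / ‖z‖) ε _ ?_ ?_)
    · simp [hz.ne']
    · have : z - z / ‖z‖ = z / ‖z‖ * ((‖z‖ - 1 : ℝ) : ℂ) := by
        push_cast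
        field_simp
      rw [dist_eq_norm, this, norm_mul, norm_div, norm_real, norm_real, norm_norm,
        div_self hz.ne', one_mul, Real.norm_eq_abs]
      exact (abs_le.2 ⟨by linarith, by linarith⟩).trans (min_le_left _ _)
  have hcomp : IsCompact (Metric.closedBall (0 : ℂ) (1 + δ) \ Metric.ball 0 (1 - δ)) :=
    (isCompact_closedBall _ _).diff Metric.isOpen_ball
  have hmem : ∀ z : ℂ, z ∈ Metric.closedBall (0 : ℂ) (1 + δ) \ Metric.ball 0 (1 - δ) ↔
      1 - δ ≤ ‖z‖ ∧ ‖z‖ ≤ 1 + δ := by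
    intro z
    simp [and_comm]
  obtain ⟨M, hM⟩ := hcomp.exists_bound_of_continuousOn (f := f.extension)
    fun z hz => (han z ((hmem z).1 hz).1 ((hmem z).1 hz).2).continuousAt.continuousWithinAt
  have hM' : ∀ z : ℂ, 1 - δ ≤ ‖z‖ → ‖z‖ ≤ 1 + δ → ‖f.extension z‖ ≤ M :=
    fun z h1 h2 => hM z ((hmem z).2 ⟨h1, h2⟩)
  refine ⟨δ, hδ0, hδ1, M, (norm_nonneg _).trans (hM' 1 (by simp [hδ0.le]) (by simp [hδ0.le])),
    fun ρ h1 h2 k => ?_⟩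
  have hρ : 0 < ρ := by linarith
  have hdiff : ∀ z : ℂ, 1 - δ ≤ ‖z‖ → ‖z‖ ≤ 1 + δ →
      DifferentiableAt ℂ (fun z => f.extension z * z ^ (-k) * z⁻¹) z := by
    intro z h1 h2
    have hz : z ≠ 0 := norm_pos_iff.1 (by linarith)
    exact ((han z h1 h2).differentiableAt.mul (differentiableAt_zpow.2 (Or.inl hz))).mul
      (differentiableAt_inv hz)
  have hint : ∀ r R : ℝ, 1 - δ ≤ r → r ≤ R → R ≤ 1 + δ →
      (∮ z in C(0, R), f.extension z * z ^ (-k) * z⁻¹) = ∮ z in C(0, r), f.extension z * z ^ (-k) * z⁻¹ := by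
    intro r R hr hrR hR
    refine circleIntegral_eq_of_differentiable_on_annulus_off_countable (by linarith) hrR
      Set.countable_empty ?_ ?_
    · intro z hz
      have h : r ≤ ‖z‖ ∧ ‖z‖ ≤ R := by simpa [and_comm] using hz
      exact (hdiff z (by linarith) (by linarith)).continuousAt.continuousWithinAt
    · intro z hz
      have h : r < ‖z‖ ∧ ‖z‖ < R := by simpa [and_comm] using hz
      exact hdiff z (by linarith) (by linarith)
  have heq : f.coeff k = (2 * π * I)⁻¹ • ∮ z in C(0, ρ), f.extension z * z ^ (-k) * z⁻¹ := by
    rw [coeff, smul_eq_mul]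
    rcases le_total ρ 1 with h | h
    · rw [hint ρ 1 h1 h (by linarith)]
    · rw [hint 1 ρ (by linarith) h h2]
  rw [heq]
  refine (circleIntegral.norm_two_pi_i_inv_smul_integral_le_of_norm_le_const
    (C := M * ρ ^ (-k) * ρ⁻¹) hρ.le fun z hz => ?_).trans (le_of_eq ?_)
  · have hz' : ‖z‖ = ρ := by simpa using hz
    rw [norm_mul, norm_mul, norm_zpow, norm_inv, hz']
    gcongr
    exact hM' z (by linarith) (by linarith)
  · field_simp

/-- The Laurent coefficients decay geometrically. -/
theorem exists_coeff_bound (f : HoloCircle) : ∃ r : ℝ, 0 < r ∧ r < 1 ∧ ∃ M : ℝ, ∀ k : ℕ,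
    ‖f.coeff k‖ ≤ M * r ^ k ∧ ‖f.coeff (-k)‖ ≤ M * r ^ k := by
  obtain ⟨δ, h0, h1, M, hM0, hM⟩ := exists_coeff_le f
  refine ⟨max (1 - δ) (1 + δ)⁻¹, lt_max_of_lt_left (by linarith),
    max_lt (by linarith) (inv_lt_one_of_one_lt₀ (by linarith)), M, fun k => ⟨?_, ?_⟩⟩
  · refine (hM (1 + δ) (by linarith) le_rfl k).trans ?_
    rw [zpow_neg, zpow_natCast, ← inv_pow]
    have : 0 ≤ (1 + δ)⁻¹ := inv_nonneg.2 (by linarith)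
    gcongr
    exact le_max_right _ _
  · refine (hM (1 - δ) le_rfl (by linarith) (-k)).trans ?_
    rw [neg_neg, zpow_natCast]
    have : 0 ≤ 1 - δ := by linarith
    gcongr
    exact le_max_left _ _

theorem summable_bound (f : HoloCircle) : ∃ b : ℕ → ℝ, Summable b ∧
    (∀ (k : ℕ) (z : ℂ), z ∈ Metric.sphere (0 : ℂ) 1 → ‖f.coeff (k + 1) * z ^ (k + 1)‖ ≤ b k) ∧
    (∀ (k : ℕ) (z : ℂ), z ∈ Metric.sphere (0 : ℂ) 1 → ‖f.coeff (-k) * z⁻¹ ^ k‖ ≤ b k) := by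
  obtain ⟨r, h0, h1, M, hM⟩ := exists_coeff_bound f
  have hMr : ∀ k, 0 ≤ M * r ^ k := fun k => (norm_nonneg _).trans (hM k).1
  refine ⟨fun k => M * r ^ k + M * r ^ (k + 1), ?_, fun k z hz => ?_, fun k z hz => ?_⟩
  · have h := (summable_geometric_of_lt_one h0.le h1).mul_left M
    exact h.add ((summable_nat_add_iff 1).2 h)
  · have hz' : ‖z‖ = 1 := by simpa using hz
    have := (hM (k + 1)).1
    push_cast at this
    simpa [hz'] using this.trans (le_add_of_nonneg_left (hMr k))
  · have hz' : ‖z‖ = 1 := by simpa using hz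
    simpa [hz'] using (hM k).2.trans (le_add_of_nonneg_right (hMr (k + 1)))

theorem geOne_continuousOn (f : HoloCircle) :
    ContinuousOn f.geOne (Metric.sphere (0 : ℂ) 1) := by
  obtain ⟨b, hb, h1, -⟩ := summable_bound f
  exact continuousOn_tsum (fun k => by fun_prop) hb h1

theorem leZero_continuousOn (f : HoloCircle) :
    ContinuousOn f.leZero (Metric.sphere (0 : ℂ) 1) := by
  obtain ⟨b, hb, -, h2⟩ := summable_bound f
  exact continuousOn_tsum (fun k => continuousOn_const.mul
    ((continuousOn_id.inv₀ fun z hz => sphere_ne_zero hz).pow k)) hb h2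

theorem geOne_add (f g : HoloCircle) {z : ℂ} (hz : z ∈ Metric.sphere (0 : ℂ) 1) :
    (f + g).geOne z = f.geOne z + g.geOne z := by
  obtain ⟨b, hb, h1, -⟩ := summable_bound f
  obtain ⟨c, hc, h2, -⟩ := summable_bound g
  unfold geOne
  rw [← (Summable.of_norm_bounded hb fun k => h1 k z hz).tsum_add
    (Summable.of_norm_bounded hc fun k => h2 k z hz)]
  simp only [coeff_add, add_mul]

theorem leZero_add (f g : HoloCircle) {z : ℂ} (hz : z ∈ Metric.sphere (0 : ℂ) 1) :
    (f + g).leZero z = f.leZero z + g.leZero z := by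
  obtain ⟨b, hb, -, h1⟩ := summable_bound f
  obtain ⟨c, hc, -, h2⟩ := summable_bound g
  unfold leZero
  rw [← (Summable.of_norm_bounded hb fun k => h1 k z hz).tsum_add
    (Summable.of_norm_bounded hc fun k => h2 k z hz)]
  simp only [coeff_add, add_mul]

theorem geOne_smul (c : ℂ) (f : HoloCircle) (z : ℂ) : (c • f).geOne z = c * f.geOne z := by
  unfold geOne
  simp only [coeff_smul, mul_assoc, tsum_mul_left]

theorem leZero_smul (c : ℂ) (f : HoloCircle) (z : ℂ) : (c • f).leZero z = c * f.leZero z := by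
  unfold leZero
  simp only [coeff_smul, mul_assoc, tsum_mul_left]

/-- The monomial `zⁿ`, `n ∈ ℤ`. -/
def monomial (n : ℤ) : HoloCircle :=
  ⟨fun z => (z : ℂ) ^ n, fun w => w ^ n,
    fun _ hz => analyticAt_id.zpow (sphere_ne_zero hz), fun _ => rfl⟩

end HoloCircle

/-! ### Points, tangent vectors, superpotentials, metric -/

/-- Points of the 2D Toda Dubrovin--Frobenius manifold in the coordinates `(w(z), v, u)`. -/
abbrev Point := HoloCircle × ℂ × ℂ

/-- Tangent vectors in the coordinates `(X(z), X_v, X_u)`: elements of `ℋ(S¹) ⊕ ℂ²`. -/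
abbrev Tangent := HoloCircle × ℂ × ℂ

/-- The cotangent space: the algebraic dual of the tangent space. -/
abbrev Cotangent := Module.Dual ℂ Tangent

/-- The superpotential `λ(z) = w_{≤ 0}(z) + z - v - eᵘ z⁻¹`. -/
def lam (P : Point) (z : ℂ) : ℂ := P.1.leZero z + z - P.2.1 - exp P.2.2 * z⁻¹

/-- The superpotential `λ̄(z) = w_{≥ 1}(z) - z + v + eᵘ z⁻¹`. -/
def lamBar (P : Point) (z : ℂ) : ℂ := P.1.geOne z - z + P.2.1 + exp P.2.2 * z⁻¹

/-- `λ_σ(z) = σ λ̄(z) + (σ - 1) λ(z)`. -/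
def lamSigma (σ : ℂ) (P : Point) (z : ℂ) : ℂ := σ * lamBar P z + (σ - 1) * lam P z

/-- The function `σ(z) = λ'(z) / (λ'(z) + λ̄'(z))` on the unit circle. -/
def sigmaAt (P : Point) (z : ℂ) : ℂ := deriv (lam P) z / (deriv (lam P) z + deriv (lamBar P) z)

/-- `⟨dλ(z), X̂⟩ = X_{≤ 0}(z) - X_v - eᵘ X_u z⁻¹` at the point `P`. -/
def dLam (P : Point) (z : ℂ) (X : Tangent) : ℂ :=
  X.1.leZero z - X.2.1 - exp P.2.2 * X.2.2 * z⁻¹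

/-- `⟨dλ̄(z), X̂⟩ = X_{≥ 1}(z) + X_v + eᵘ X_u z⁻¹` at the point `P`. -/
def dLamBar (P : Point) (z : ℂ) (X : Tangent) : ℂ :=
  X.1.geOne z + X.2.1 + exp P.2.2 * X.2.2 * z⁻¹

/-- `⟨dλ_σ(z), X̂⟩`, for fixed `σ` and `z`. -/
def dLamSigma (σ : ℂ) (P : Point) (z : ℂ) (X : Tangent) : ℂ :=
  σ * dLamBar P z X + (σ - 1) * dLam P z X

/-- The metric `η(X̂, Ŷ) = (1 / 2πi) ∮ X(z) Y(z) / (z² w'(z)) dz + X_v Y_u + X_u Y_v`,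
with `w = λ + λ̄`. -/
def metric (P : Point) (X Y : Tangent) : ℂ :=
  (2 * π * I)⁻¹ * (∮ z in C(0, 1),
      X.1.extension z * Y.1.extension z / (z ^ 2 * (deriv (lam P) z + deriv (lamBar P) z)))
    + X.2.1 * Y.2.2 + X.2.2 * Y.2.1

/-- A cotangent vector is representable if it is of the form `η(Ẑ, ·)`. -/
def IsRepresentable (P : Point) (ξ : Cotangent) : Prop :=
  ∃ Z : Tangent, ∀ X : Tangent, ξ X = metric P Z X

/-- The special point `(w(z), v, u) = (z, v, u)`. -/
def specialPoint (v u : ℂ) : Point := (HoloCircle.monomial 1, v, u)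

/-! ### The integral solutions

The variable `ζ` lives on the universal covering of `ℂ*`: it is `ζ = exp ℓ`, and
`ζ^{1/2} = exp (ℓ / 2)`. -/

/-- `y_σ(ζ) = ζ^{-1/2} / (2πi) ∮ e^{ζ λ_σ(z)} dz / z`, as a functional of the point. -/
def yInt (σ ℓ : ℂ) (P : Point) : ℂ :=
  exp (-(ℓ / 2)) * ((2 * π * I)⁻¹ * ∮ z in C(0, 1), exp (exp ℓ * lamSigma σ P z) * z⁻¹)

theorem lamSigma_continuousOn (σ : ℂ) (P : Point) :
    ContinuousOn (lamSigma σ P) (Metric.sphere (0 : ℂ) 1) := by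
  have hinv : ContinuousOn (fun z : ℂ => z⁻¹) (Metric.sphere (0 : ℂ) 1) :=
    continuousOn_id.inv₀ fun z hz => HoloCircle.sphere_ne_zero hz
  have h1 := P.1.geOne_continuousOn
  have h2 := P.1.leZero_continuousOn
  unfold lamSigma lamBar lam
  fun_prop

theorem dLamSigma_continuousOn (σ : ℂ) (P : Point) (X : Tangent) :
    ContinuousOn (fun z => dLamSigma σ P z X) (Metric.sphere (0 : ℂ) 1) := by
  have hinv : ContinuousOn (fun z : ℂ => z⁻¹) (Metric.sphere (0 : ℂ) 1) :=
    continuousOn_id.inv₀ fun z hz => HoloCircle.sphere_ne_zero hz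
  have h1 := X.1.geOne_continuousOn
  have h2 := X.1.leZero_continuousOn
  unfold dLamSigma dLamBar dLam
  fun_prop

theorem dLamSigma_add (σ : ℂ) (P : Point) {z : ℂ} (hz : z ∈ Metric.sphere (0 : ℂ) 1)
    (X Y : Tangent) : dLamSigma σ P z (X + Y) = dLamSigma σ P z X + dLamSigma σ P z Y := by
  simp only [dLamSigma, dLamBar, dLam, Prod.fst_add, Prod.snd_add, HoloCircle.geOne_add _ _ hz,
    HoloCircle.leZero_add _ _ hz]
  ring

theorem dLamSigma_smul (σ : ℂ) (P : Point) (z c : ℂ) (X : Tangent) :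
    dLamSigma σ P z (c • X) = c * dLamSigma σ P z X := by
  simp only [dLamSigma, dLamBar, dLam, Prod.smul_fst, Prod.smul_snd, HoloCircle.geOne_smul,
    HoloCircle.leZero_smul, smul_eq_mul]
  ring

theorem circleIntegrable_dy (σ ℓ : ℂ) (P : Point) (X : Tangent) : CircleIntegrable
    (fun z => exp (exp ℓ * lamSigma σ P z) * dLamSigma σ P z X * z⁻¹) 0 1 := by
  refine ContinuousOn.circleIntegrable zero_le_one ?_
  exact (((continuousOn_const.mul (lamSigma_continuousOn σ P)).cexp).mul
    (dLamSigma_continuousOn σ P X)).mul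
    (continuousOn_id.inv₀ fun z hz => HoloCircle.sphere_ne_zero hz)

/-- The integral solution
`⟨dy_σ(ζ), X̂⟩ = ζ^{1/2} / (2πi) ∮ e^{ζ λ_σ(z)} ⟨dλ_σ(z), X̂⟩ dz / z`. -/
def dy (σ ℓ : ℂ) (P : Point) : Cotangent where
  toFun X := exp (ℓ / 2) * ((2 * π * I)⁻¹ * ∮ z in C(0, 1),
    exp (exp ℓ * lamSigma σ P z) * dLamSigma σ P z X * z⁻¹)
  map_add' X Y := by
    rw [← mul_add, ← mul_add, ← circleIntegral.integral_add (circleIntegrable_dy σ ℓ P X)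
      (circleIntegrable_dy σ ℓ P Y)]
    congr 2
    refine circleIntegral.integral_congr zero_le_one fun z hz => ?_
    simp only [dLamSigma_add σ P hz]
    ring
  map_smul' c X := by
    simp only [RingHom.id_apply, smul_eq_mul]
    rw [mul_left_comm c, mul_left_comm c, ← circleIntegral.integral_const_mul c]
    congr 2
    refine circleIntegral.integral_congr zero_le_one fun z _ => ?_
    simp only [dLamSigma_smul]
    ring

/-! ### Test vectors and weak functionals -/

/-- The test vectors `ℂ[z, z⁻¹] ⊕ ℂ²`. -/
abbrev Test := LaurentPolynomial ℂ × ℂ × ℂ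

/-- Laurent polynomials as elements of `ℋ(S¹)`: `∑ aₙ zⁿ`. -/
def laurentToHolo : LaurentPolynomial ℂ →ₗ[ℂ] HoloCircle :=
  Finsupp.linearCombination ℂ HoloCircle.monomial ∘ₗ
    (AddMonoidAlgebra.coeffLinearEquiv ℂ : LaurentPolynomial ℂ ≃ₗ[ℂ] (ℤ →₀ ℂ)).toLinearMap

/-- The inclusion of the test vectors in the tangent space. -/
def testIncl : Test →ₗ[ℂ] Tangent := laurentToHolo.prodMap LinearMap.id

/-- Elements of the algebraic dual of the space of test vectors. -/
abbrev WeakCotangent := Module.Dual ℂ Test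

/-- The test vector `e_m = (zᵐ, 0, 0)`. -/
def eZ (m : ℤ) : Test := (LaurentPolynomial.T m, 0, 0)

/-- The test vector `e_v = (0, 1, 0)`. -/
def eV : Test := (0, 1, 0)

/-- The test vector `e_u = (0, 0, 1)`. -/
def eU : Test := (0, 0, 1)

/-- The weak cotangent vector with prescribed coefficients:
`(X(z), X_v, X_u) ↦ ∑ₙ Xₙ Cₙ + X_v C_v + X_u C_u`. -/
def weakOfCoeffs (C : ℤ → ℂ) (Cv Cu : ℂ) : WeakCotangent :=
  (Finsupp.linearCombination ℂ C ∘ₗ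
    (AddMonoidAlgebra.coeffLinearEquiv ℂ : LaurentPolynomial ℂ ≃ₗ[ℂ] (ℤ →₀ ℂ)).toLinearMap).coprod
    ((LinearMap.toSpanSingleton ℂ ℂ Cv).coprod (LinearMap.toSpanSingleton ℂ ℂ Cu))

/-! ### Borel resummation -/

/-- `F` is the analytic continuation, along the closed ray of direction `θ`, of the sum of the
Borel transform `∑ aₖ χᵏ / k!` of the formal series `∑ aₖ ζ⁻ᵏ`. -/
def IsBorelTransformAlong (a : ℕ → ℂ) (θ : ℝ) (F : ℂ → ℂ) : Prop :=
  (∀ᶠ χ in 𝓝 (0 : ℂ), HasSum (fun k : ℕ => a k / (k.factorial : ℂ) * χ ^ k) (F χ)) ∧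
  AnalyticOnNhd ℂ F {χ | ∃ t : ℝ, 0 ≤ t ∧ χ = t * exp (θ * I)}

/-- `S` is the Borel resummation in the direction `θ` of the formal series `∑ aₖ ζ⁻ᵏ`: it is the
analytic continuation to the universal covering of `ℂ*` (on which `ζ = exp ℓ`) of the function
`ζ ∫ F(χ) e^{-ζ χ} dχ`, with integration along the ray of direction `θ`, which is defined on the
sector `-θ - π/2 < arg ζ < -θ + π/2`. -/
def IsBorelSum (a : ℕ → ℂ) (θ : ℝ) (S : ℂ → ℂ) : Prop :=
  Differentiable ℂ S ∧ ∃ F : ℂ → ℂ, IsBorelTransformAlong a θ F ∧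
    ∀ ℓ : ℂ, |ℓ.im + θ| < π / 2 →
      IntegrableOn (fun t : ℝ => F (t * exp (θ * I)) * exp (-(exp ℓ * (t * exp (θ * I)))) *
        exp (θ * I)) (Set.Ioi 0) ∧
      S ℓ = exp ℓ * ∫ t in Set.Ioi (0 : ℝ),
        F (t * exp (θ * I)) * exp (-(exp ℓ * (t * exp (θ * I)))) * exp (θ * I)

open Classical in
/-- The Borel resummation of the formal series `∑ aₖ ζ⁻ᵏ` (zero if it does not exist). -/
def borelSum (a : ℕ → ℂ) (θ : ℝ) : ℂ → ℂ :=
  if h : ∃ S, IsBorelSum a θ S then h.choose else 0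

/-- The coefficients of the formal series
`φ_p^m(ζ) = ∑ₖ Γ(1/2 - k)⁻¹ (m + k - 1/2 choose 2k) (p / (ζ eᵘ))ᵏ`. -/
def phiCoeff (u p : ℂ) (m : ℤ) (k : ℕ) : ℂ :=
  (Gamma (1 / 2 - k))⁻¹ * Ring.choose ((m : ℂ) + k - 1 / 2) (2 * k) * (p / exp u) ^ k

/-- The direction opposite to the one, `arg eᵘ - arg p`, of the singularity `4 eᵘ / p` of the Borel
transforms of the `φ_p^m`; here `arg eᵘ = Im u` and `arg p = α`. -/
def direction (u : ℂ) (α : ℝ) : ℝ := u.im - α - π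

/-- The resummation `s(φ_p^m)(ζ)`, for `p = exp (i α)` and `ζ = exp ℓ`. -/
def sPhi (u : ℂ) (α : ℝ) (m : ℤ) (ℓ : ℂ) : ℂ :=
  borelSum (phiCoeff u (exp (α * I)) m) (direction u α) ℓ

/-- The resummed weak functional `ds_p(ζ)` at the special point `(z, v, u)`, where `p = exp (i α)`
(the functional is multivalued in `p`, and `α` is the chosen argument of `p`) and `ζ = exp ℓ`.
It is obtained from the formal integral solution, whose coefficients are
`e^{ζ u_p} / 2` times `σ(p) pᵐ √(p/eᵘ) φ_p^m` (for `m ≥ 1`), `(σ(p) - 1) pᵐ √(p/eᵘ) φ_p^m`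
(for `m ≤ 0`), `√(p/eᵘ) φ_p^0` and `√(eᵘ/p) φ_p^{-1}`, by resummation of the formal series.
Here `u_p = λ_{σ(p)}(p)` and `√(p/eᵘ) = exp ((i α - u) / 2)`. -/
def ds (v u : ℂ) (α : ℝ) (ℓ : ℂ) : WeakCotangent :=
  let P := specialPoint v u
  let p := exp (α * I)
  let σ := sigmaAt P p
  let E := exp (exp ℓ * lamSigma σ P p) * (1 / 2)
  let r := exp ((α * I - u) / 2)
  weakOfCoeffs
    (fun m => E * (if 1 ≤ m then σ else σ - 1) * p ^ m * r * sPhi u α m ℓ)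
    (E * r * sPhi u α 0 ℓ)
    (E * r⁻¹ * sPhi u α (-1) ℓ)

/-- The modified Bessel function of the first kind of integer order,
`I_m(z) = ∑ₖ (z/2)^{2k+m} / (Γ(k + m + 1) k!)`. (At the poles of `Γ` its value here is `0`, so
that the corresponding terms vanish, as they should.) -/
def besselI (m : ℤ) (z : ℂ) : ℂ :=
  ∑' k : ℕ, (z / 2) ^ (2 * (k : ℤ) + m) / (Gamma (k + m + 1) * (k.factorial : ℂ))

end TodaDF

end

/-! At the special point `λ_σ(z) = v + (σ - 1) z + eᵘ/z`. For `σ = σ(p)` the critical points are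
`±p`, and with `x = 2 ζ eᵘ/p` the exponential `e^{ζ λ_σ}` is `e^{ζ v}` times the Bessel generating
function `exp ((x/2)(z/p + p/z))`. Its Laurent coefficients give the `I_m(x)` (`circleIntegral_exp`,
`circleIntegral_besselI`).

The two resummed functionals are Bessel functions of the second kind at `±p`. Up to `1/√π`, the
Borel transform of `φ_p^m` is `₂F₁(1/2 + m, 1/2 - m; 1; χ p/(4 eᵘ))`. It is an angular mean of
`T_m(1 - 2y)/√(1 - y)` at `y = x sin² φ` (`hasSum_hyp`), and this continues it along the ray
opposite to the singularity. Its Laplace transform is a Gaussian integral over the plane in polar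
coordinates. One Cartesian variable integrates out, and the substitution `a = sinh τ` in the other
yields `K_m` (`laplaceHyp_eq_gaussian`, `integral_chebRoot`). This is done for real `Λ = log (-ζ
eᵘ/p)` and extended by the identity theorem (`laplaceHyp_eq`). Every coefficient of `ds_p` then
becomes `-(i/π) ζ^{1/2} e^{ζ v} K_m(2 e^Λ)` times an elementary factor (`resummed_coefficient`).

Replacing `p` by `-p` with argument `α - π` moves `Λ` to `Λ + π i`. The identity `dy_σ = ds_p -
ds_{-p}` is therefore the half-turn monodromy `K_m(x e^{-π i}) = (-1)^m K_m(x) + π i I_m(x)`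
(`macK_sub_pi_I`). For it, `K_m` is written as an entire function of `L` built from two half-line
integrals, unchanged by `L ↦ L - π i`, and one segment integral, which changes by a contour integral
around the circle.

Representability holds because the projections `≥ 1` and `≤ 0` are adjoint for the pairing `∮ f g
dz/z²` (`HoloCircle.circleIntegral_geOne_mul`), so the projection can be moved from the tangent
vector to the kernel. -/

noncomputable section

namespace TodaDF

/-! ### Parametric integrals and series -/

/-- An integral of a locally dominated holomorphic family is holomorphic in the parameter, and can
be differentiated under the integral sign. -/
theorem hasDerivAt_integral_of_holomorphic {β : Type*} [MeasurableSpace β] {μ : Measure β}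
    {f : ℂ → β → ℂ} {z₀ : ℂ} {r : ℝ} (hr : 0 < r) {bound : β → ℝ} (hb : Integrable bound μ)
    (hm : ∀ z ∈ Metric.ball z₀ r, AEStronglyMeasurable (f z) μ)
    (hle : ∀ᵐ a ∂μ, ∀ z ∈ Metric.ball z₀ r, ‖f z a‖ ≤ bound a)
    (hd : ∀ᵐ a ∂μ, DifferentiableOn ℂ (fun z => f z a) (Metric.ball z₀ r)) :
    HasDerivAt (fun z => ∫ a, f z a ∂μ) (∫ a, deriv (fun z => f z a) z₀ ∂μ) z₀ := by
  have hsub : ∀ z ∈ Metric.ball z₀ (r / 2), Metric.closedBall z (r / 4) ⊆ Metric.ball z₀ r := by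
    intro z hz w hw
    rw [Metric.mem_ball] at hz ⊢
    rw [Metric.mem_closedBall] at hw
    linarith [dist_triangle w z z₀]
  have hmem : z₀ ∈ Metric.ball z₀ r := Metric.mem_ball_self hr
  -- No bound on the derivative is assumed: Cauchy's estimate on discs of radius `r / 4` about
  -- points of the half-size ball supplies `bound / (r / 4)`.
  refine (hasDerivAt_integral_of_dominated_loc_of_deriv_le (F' := fun z a => deriv (fun w => f w a) z)
    (bound := fun a => bound a / (r / 4)) (Metric.ball_mem_nhds z₀ (half_pos hr)) ?_ ?_ ?_ ?_ ?_ ?_).2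
  · filter_upwards [Metric.ball_mem_nhds z₀ hr] with z hz using hm z hz
  · exact hb.mono' (hm z₀ hmem) (hle.mono fun a ha => ha z₀ hmem)
  -- The derivative at `z₀` is measurable in `a` as a pointwise limit of difference quotients along
  -- a sequence in the ball.
  · have hlim : Tendsto (fun n : ℕ => z₀ + ((r / 2 * (1 / ((n : ℝ) + 1)) : ℝ) : ℂ)) atTop
        (𝓝[≠] z₀) := by
      refine tendsto_nhdsWithin_iff.2 ⟨?_, Eventually.of_forall fun n => ?_⟩
      · have h := (tendsto_one_div_add_atTop_nhds_zero_nat (𝕜 := ℝ)).const_mul (r / 2)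
        rw [mul_zero] at h
        have h' := (continuous_ofReal.tendsto 0).comp h
        simpa using h'.const_add z₀
      · have : (0 : ℝ) < r / 2 * (1 / ((n : ℝ) + 1)) := by positivity
        have h2 : ((r / 2 * (1 / ((n : ℝ) + 1)) : ℝ) : ℂ) ≠ 0 := by exact_mod_cast this.ne'
        simpa only [Set.mem_compl_iff, Set.mem_singleton_iff, add_eq_left] using h2
    refine aestronglyMeasurable_of_tendsto_ae atTop
      (f := fun (n : ℕ) a => slope (fun w => f w a) z₀
        (z₀ + ((r / 2 * (1 / ((n : ℝ) + 1)) : ℝ) : ℂ))) (fun n => ?_) ?_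
    · have hn : z₀ + ((r / 2 * (1 / ((n : ℝ) + 1)) : ℝ) : ℂ) ∈ Metric.ball z₀ r := by
        have h0 : (0 : ℝ) < r / 2 * (1 / ((n : ℝ) + 1)) := by positivity
        have h1 : 1 / ((n : ℝ) + 1) ≤ 1 := by
          rw [div_le_one (by positivity)]
          linarith [(Nat.cast_nonneg n : (0 : ℝ) ≤ n)]
        rw [Metric.mem_ball, dist_eq_norm, add_sub_cancel_left, norm_real, Real.norm_eq_abs,
          abs_of_pos h0]
        nlinarith
      simp only [slope_def_field, div_eq_mul_inv]
      exact ((hm _ hn).sub (hm _ hmem)).mul aestronglyMeasurable_const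
    · filter_upwards [hd] with a ha
      have := (ha.differentiableAt (Metric.ball_mem_nhds z₀ hr)).hasDerivAt
      exact (hasDerivAt_iff_tendsto_slope.1 this).comp hlim
  · filter_upwards [hle, hd] with a ha hda z hz
    refine norm_deriv_le_of_forall_mem_sphere_norm_le (by linarith) ?_ ?_
    · refine (hda.mono ?_).diffContOnCl_ball (hsub z hz)
      exact subset_rfl
    · exact fun w hw => ha w (hsub z hz (Metric.sphere_subset_closedBall hw))
  · exact hb.div_const _
  · filter_upwards [hd] with a ha z hz
    exact (ha.differentiableAt (Metric.isOpen_ball.mem_nhds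
      (hsub z hz (Metric.mem_closedBall_self (by linarith))))).hasDerivAt

/-- Differentiation under the integral sign for a jointly continuous holomorphic family on a
bounded interval. -/
theorem hasDerivAt_intervalIntegral_of_holomorphic {f : ℂ → ℝ → ℂ} {a b : ℝ} {U : Set ℂ}
    (hU : IsOpen U) (hc : ContinuousOn (fun q : ℂ × ℝ => f q.1 q.2) (U ×ˢ Set.uIcc a b))
    (hd : ∀ t ∈ Set.uIcc a b, DifferentiableOn ℂ (fun z => f z t) U) {z₀ : ℂ} (hz₀ : z₀ ∈ U) :
    HasDerivAt (fun z => ∫ t in a..b, f z t) (∫ t in a..b, deriv (fun z => f z t) z₀) z₀ := by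
  obtain ⟨r, hr, hrU⟩ := Metric.nhds_basis_closedBall.mem_iff.1 (hU.mem_nhds hz₀)
  obtain ⟨M, hM⟩ := ((isCompact_closedBall z₀ r).prod (isCompact_uIcc (a := a) (b := b)))
    |>.exists_bound_of_continuousOn (hc.mono (Set.prod_mono hrU subset_rfl))
  have hsub : Metric.ball z₀ r ⊆ U := Metric.ball_subset_closedBall.trans hrU
  have key := hasDerivAt_integral_of_holomorphic (μ := volume.restrict (Set.uIoc a b)) (f := f)
    (z₀ := z₀) hr (bound := fun _ => M) ?_ ?_ ?_ ?_
  · simp only [intervalIntegral.intervalIntegral_eq_integral_uIoc]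
    exact key.const_smul _
  · exact intervalIntegrable_const.def'
  · intro z hz
    refine ContinuousOn.aestronglyMeasurable ?_ measurableSet_uIoc
    refine (hc.comp (f := fun t : ℝ => (z, t)) (by fun_prop) ?_)
    exact fun t ht => ⟨hsub hz, Set.uIoc_subset_uIcc ht⟩
  · filter_upwards [ae_restrict_mem measurableSet_uIoc] with t ht z hz
    exact hM (z, t) ⟨Metric.ball_subset_closedBall hz, Set.uIoc_subset_uIcc ht⟩
  · filter_upwards [ae_restrict_mem measurableSet_uIoc] with t ht
    exact (hd t (Set.uIoc_subset_uIcc ht)).mono hsub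

/-- Termwise integration of a normally convergent series over the unit circle. -/
theorem hasSum_circleIntegral {f : ℕ → ℂ → ℂ} {g : ℂ → ℂ} {b : ℕ → ℝ}
    (hf : ∀ n, ContinuousOn (f n) (Metric.sphere 0 1)) (hb : Summable b)
    (hle : ∀ n, ∀ z ∈ Metric.sphere (0 : ℂ) 1, ‖f n z‖ ≤ b n)
    (hg : ∀ z ∈ Metric.sphere (0 : ℂ) 1, HasSum (fun n => f n z) (g z)) :
    HasSum (fun n => ∮ z in C(0, 1), f n z) (∮ z in C(0, 1), g z) := by
  have hmem : ∀ t : ℝ, circleMap 0 1 t ∈ Metric.sphere (0 : ℂ) 1 :=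
    fun t => circleMap_mem_sphere 0 zero_le_one t
  refine intervalIntegral.hasSum_integral_of_dominated_convergence (fun n _ => b n)
    (fun n => ?_) (fun n => ?_) (Eventually.of_forall fun t _ => hb) ?_ ?_
  · have h1 : Continuous fun t : ℝ => f n (circleMap 0 1 t) :=
      (hf n).comp_continuous (continuous_circleMap 0 1) hmem
    have h2 : Continuous fun t : ℝ => deriv (circleMap 0 1) t := by
      simp only [deriv_circleMap]
      exact (continuous_circleMap 0 1).mul continuous_const
    exact (h2.smul h1).aestronglyMeasurable
  · refine Eventually.of_forall fun t _ => ?_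
    rw [norm_smul, deriv_circleMap]
    simpa using hle n _ (hmem t)
  · exact intervalIntegrable_const
  · exact Eventually.of_forall fun t _ => (hg _ (hmem t)).const_smul _

/-! ### Laurent coefficients of `exp (a z + b / z)` -/

theorem circleIntegral_zpow (n : ℤ) :
    (∮ z in C(0, 1), z ^ n * z⁻¹) = if n = 0 then 2 * π * I else 0 := by
  have h : (∮ z in C(0, 1), z ^ n * z⁻¹) = ∮ z in C(0, 1), (z - 0) ^ (n - 1) := by
    refine circleIntegral.integral_congr zero_le_one fun z hz => ?_
    rw [sub_zero, zpow_sub_one₀ (HoloCircle.sphere_ne_zero hz)]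
  rw [h]
  split_ifs with h0
  · subst h0
    simp only [zero_sub, zpow_neg_one]
    exact circleIntegral.integral_sub_center_inv 0 one_ne_zero
  · exact circleIntegral.integral_sub_zpow_of_ne (by omega) _ _ _

theorem hasSum_exp (z : ℂ) : HasSum (fun n : ℕ => z ^ n / (n.factorial : ℂ)) (exp z) := by
  rw [exp_eq_exp_ℂ]
  exact NormedSpace.expSeries_div_hasSum_exp z

theorem summable_pow_div_factorial (x : ℝ) : Summable fun n : ℕ => x ^ n / (n.factorial : ℝ) :=
  Real.summable_pow_div_factorial x

theorem continuousOn_zpow_sphere (n : ℤ) :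
    ContinuousOn (fun z : ℂ => z ^ n) (Metric.sphere (0 : ℂ) 1) :=
  continuousOn_id.zpow₀ n fun _ hz => Or.inl (HoloCircle.sphere_ne_zero hz)

theorem continuousOn_inv_sphere : ContinuousOn (fun z : ℂ => z⁻¹) (Metric.sphere (0 : ℂ) 1) :=
  continuousOn_id.inv₀ fun _ hz => HoloCircle.sphere_ne_zero hz

/-- Only the term `k = n` of the exponential series has a residue. For `n < 0` there is none, and
the right side vanishes too, because `Gamma` is `0` at its poles and division by `0` gives `0`. -/
theorem circleIntegral_exp_inv {b : ℂ} (hb : b ≠ 0) (n : ℤ) :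
    (∮ z in C(0, 1), exp (b * z⁻¹) * z ^ n * z⁻¹) = 2 * π * I * (b ^ n / Gamma (n + 1)) := by
  have key := hasSum_circleIntegral
    (f := fun (k : ℕ) z => (b * z⁻¹) ^ k / (k.factorial : ℂ) * z ^ n * z⁻¹)
    (g := fun z => exp (b * z⁻¹) * z ^ n * z⁻¹) (b := fun k => ‖b‖ ^ k / (k.factorial : ℝ))
    (fun k => ?_) (summable_pow_div_factorial _) (fun k z hz => ?_) fun z hz => ?_
  · have hk : ∀ k : ℕ, (∮ z in C(0, 1), (b * z⁻¹) ^ k / (k.factorial : ℂ) * z ^ n * z⁻¹) =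
        if n = k then b ^ k / (k.factorial : ℂ) * (2 * π * I) else 0 := by
      intro k
      have : (∮ z in C(0, 1), (b * z⁻¹) ^ k / (k.factorial : ℂ) * z ^ n * z⁻¹) =
          ∮ z in C(0, 1), b ^ k / (k.factorial : ℂ) * (z ^ (n - k) * z⁻¹) := by
        refine circleIntegral.integral_congr zero_le_one fun z hz => ?_
        have hz0 := HoloCircle.sphere_ne_zero hz
        simp only [zpow_sub₀ hz0, zpow_natCast, mul_pow, inv_pow]
        field_simp
      rw [this, circleIntegral.integral_const_mul, circleIntegral_zpow]
      simp only [sub_eq_zero, mul_ite, mul_zero]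
    simp only [hk] at key
    rcases le_or_gt 0 n with h | h
    · lift n to ℕ using h
      have h2 := hasSum_single (f := fun k : ℕ => if (n : ℤ) = k then
        b ^ k / (k.factorial : ℂ) * (2 * π * I) else 0) n fun k hk => by
          rw [if_neg]
          exact_mod_cast hk.symm
      rw [key.unique h2]
      simp [Gamma_nat_eq_factorial]
      ring
    · have h0 : (fun k : ℕ => if n = k then b ^ k / (k.factorial : ℂ) * (2 * π * I) else 0) =
          fun _ => 0 := by
        funext k
        rw [if_neg (by omega)]
      rw [h0] at key
      rw [key.unique hasSum_zero]
      obtain ⟨j, rfl⟩ : ∃ j : ℕ, n = -(j : ℤ) - 1 := ⟨(-n - 1).toNat, by omega⟩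
      have : (((-(j : ℤ) - 1 : ℤ) : ℂ) + 1) = -(j : ℂ) := by push_cast; ring
      rw [this, Gamma_neg_nat_eq_zero]
      simp
  · have h1 := continuousOn_zpow_sphere n
    have h2 := continuousOn_inv_sphere
    fun_prop
  · have hz' : ‖z‖ = 1 := by simpa using hz
    simp [hz', norm_zpow]
  · exact ((hasSum_exp _).mul_right _).mul_right _

/-- Expanding only `exp (a z)` reduces each term to the previous lemma with `n = k + m`. -/
theorem circleIntegral_exp {a b : ℂ} (hb : b ≠ 0) (m : ℤ) :
    (∮ z in C(0, 1), exp (a * z + b * z⁻¹) * z ^ m * z⁻¹) =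
      2 * π * I * ∑' k : ℕ, a ^ k * b ^ ((k : ℤ) + m) /
        (Gamma (k + m + 1) * (k.factorial : ℂ)) := by
  have hmem : ∀ z ∈ Metric.sphere (0 : ℂ) 1, ‖z‖ = 1 := fun z hz => by simpa using hz
  have key := hasSum_circleIntegral
    (f := fun (k : ℕ) z => (a * z) ^ k / (k.factorial : ℂ) * (exp (b * z⁻¹) * z ^ m * z⁻¹))
    (g := fun z => exp (a * z + b * z⁻¹) * z ^ m * z⁻¹)
    (b := fun k => ‖a‖ ^ k / (k.factorial : ℝ) * Real.exp ‖b‖)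
    (fun k => ?_) ((summable_pow_div_factorial _).mul_right _) (fun k z hz => ?_) fun z hz => ?_
  · rw [← key.tsum_eq, ← tsum_mul_left]
    refine tsum_congr fun k => ?_
    have : (∮ z in C(0, 1), (a * z) ^ k / (k.factorial : ℂ) * (exp (b * z⁻¹) * z ^ m * z⁻¹)) =
        ∮ z in C(0, 1), a ^ k / (k.factorial : ℂ) *
          (exp (b * z⁻¹) * z ^ ((k : ℤ) + m) * z⁻¹) := by
      refine circleIntegral.integral_congr zero_le_one fun z hz => ?_
      have hz0 := HoloCircle.sphere_ne_zero hz
      simp only [zpow_add₀ hz0, zpow_natCast]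
      ring
    rw [this, circleIntegral.integral_const_mul, circleIntegral_exp_inv hb]
    push_cast
    ring
  · have h1 := continuousOn_zpow_sphere m
    have h2 := continuousOn_inv_sphere
    fun_prop
  · have h : ‖exp (b * z⁻¹)‖ ≤ Real.exp ‖b‖ := by
      rw [norm_exp]
      refine Real.exp_le_exp.2 ((re_le_norm _).trans ?_)
      simp [hmem z hz]
    simp only [norm_mul, norm_div, norm_pow, norm_zpow, norm_inv, hmem z hz, one_zpow, mul_one,
      inv_one, norm_natCast]
    gcongr
  · rw [exp_add]
    simpa only [mul_assoc] using (hasSum_exp (a * z)).mul_right (exp (b * z⁻¹) * z ^ m * z⁻¹)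

/-! ### Monomials and the special point -/

namespace HoloCircle

theorem extension_monomial (n : ℤ) {z : ℂ} (hz : z ∈ Metric.sphere (0 : ℂ) 1) :
    (monomial n).extension z = z ^ n :=
  extension_eq (monomial n) ⟨z, hz⟩

theorem coeff_monomial (n k : ℤ) : (monomial n).coeff k = if k = n then 1 else 0 := by
  have h : (∮ z in C(0, 1), (monomial n).extension z * z ^ (-k) * z⁻¹) =
      ∮ z in C(0, 1), z ^ (n - k) * z⁻¹ := by
    refine circleIntegral.integral_congr zero_le_one fun z hz => ?_
    simp only [extension_monomial n hz, zpow_sub₀ (sphere_ne_zero hz), zpow_neg, div_eq_mul_inv]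
  rw [coeff, h, circleIntegral_zpow]
  have hpi : (2 * π * I : ℂ) ≠ 0 := two_pi_I_ne_zero
  rcases eq_or_ne k n with rfl | hk
  · rw [sub_self, if_pos rfl, if_pos rfl, inv_mul_cancel₀ hpi]
  · rw [if_neg hk, if_neg (sub_ne_zero.2 hk.symm), mul_zero]

theorem geOne_monomial (m : ℤ) (z : ℂ) :
    (monomial m).geOne z = if 1 ≤ m then z ^ m else 0 := by
  simp only [geOne, coeff_monomial]
  split_ifs with h
  · obtain ⟨n, rfl⟩ : ∃ n : ℕ, m = n + 1 := ⟨(m - 1).toNat, by omega⟩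
    rw [tsum_eq_single n fun k hk => by rw [if_neg (by omega), zero_mul]]
    simp only [if_true, one_mul]
    exact_mod_cast rfl
  · refine (tsum_congr fun k => ?_).trans tsum_zero
    rw [if_neg (by omega), zero_mul]

theorem leZero_monomial (m : ℤ) (z : ℂ) :
    (monomial m).leZero z = if 1 ≤ m then 0 else z ^ m := by
  simp only [leZero, coeff_monomial]
  split_ifs with h
  · refine (tsum_congr fun k => ?_).trans tsum_zero
    rw [if_neg (by omega), zero_mul]
  · obtain ⟨n, rfl⟩ : ∃ n : ℕ, m = -n := ⟨(-m).toNat, by omega⟩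
    rw [tsum_eq_single n fun k hk => by rw [if_neg (by omega), zero_mul]]
    simp

theorem geOne_zero (z : ℂ) : (0 : HoloCircle).geOne z = 0 := by
  simpa using geOne_smul 0 0 z

theorem leZero_zero (z : ℂ) : (0 : HoloCircle).leZero z = 0 := by
  simpa using leZero_smul 0 0 z

end HoloCircle

theorem lam_specialPoint (v u z : ℂ) : lam (specialPoint v u) z = z - v - exp u * z⁻¹ := by
  simp [lam, specialPoint, HoloCircle.leZero_monomial]

theorem lamBar_specialPoint (v u z : ℂ) : lamBar (specialPoint v u) z = v + exp u * z⁻¹ := by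
  simp [lamBar, specialPoint, HoloCircle.geOne_monomial]

theorem lamSigma_specialPoint (σ v u z : ℂ) :
    lamSigma σ (specialPoint v u) z = v + ((σ - 1) * z + exp u * z⁻¹) := by
  rw [lamSigma, lam_specialPoint, lamBar_specialPoint]
  ring

theorem deriv_lam_specialPoint (v u : ℂ) {z : ℂ} (hz : z ≠ 0) :
    deriv (lam (specialPoint v u)) z = 1 + exp u / z ^ 2 := by
  have h : HasDerivAt (lam (specialPoint v u)) (1 - exp u * (-(z ^ 2)⁻¹)) z := by
    rw [funext (lam_specialPoint v u)]
    exact ((hasDerivAt_id z).sub_const v).sub ((hasDerivAt_inv hz).const_mul _)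
  rw [h.deriv]
  ring

theorem deriv_lamBar_specialPoint (v u : ℂ) {z : ℂ} (hz : z ≠ 0) :
    deriv (lamBar (specialPoint v u)) z = -(exp u / z ^ 2) := by
  have h : HasDerivAt (lamBar (specialPoint v u)) (exp u * (-(z ^ 2)⁻¹)) z := by
    rw [funext (lamBar_specialPoint v u)]
    exact ((hasDerivAt_inv hz).const_mul _).const_add v
  rw [h.deriv]
  ring

theorem sigmaAt_specialPoint (v u : ℂ) {z : ℂ} (hz : z ≠ 0) :
    sigmaAt (specialPoint v u) z = 1 + exp u / z ^ 2 := by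
  rw [sigmaAt, deriv_lam_specialPoint v u hz, deriv_lamBar_specialPoint v u hz]
  simp

theorem metric_specialPoint (v u : ℂ) (X Y : Tangent) :
    metric (specialPoint v u) X Y =
      (2 * π * I)⁻¹ * (∮ z in C(0, 1), X.1.extension z * Y.1.extension z / z ^ 2)
        + X.2.1 * Y.2.2 + X.2.2 * Y.2.1 := by
  rw [metric]
  congr 3
  refine circleIntegral.integral_congr zero_le_one fun z hz => ?_
  have hz0 := HoloCircle.sphere_ne_zero hz
  simp only [deriv_lam_specialPoint v u hz0, deriv_lamBar_specialPoint v u hz0]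
  ring

/-! ### The integral solution is a differential -/

theorem lamSigma_add_smul (σ : ℂ) (P : Point) (X : Tangent) (t : ℂ) {z : ℂ}
    (hz : z ∈ Metric.sphere (0 : ℂ) 1) :
    lamSigma σ (P + t • X) z =
      σ * (P.1.geOne z + t * X.1.geOne z - z + (P.2.1 + t * X.2.1)
        + exp (P.2.2 + t * X.2.2) * z⁻¹)
      + (σ - 1) * (P.1.leZero z + t * X.1.leZero z + z - (P.2.1 + t * X.2.1)
        - exp (P.2.2 + t * X.2.2) * z⁻¹) := by
  simp only [lamSigma, lamBar, lam, Prod.fst_add, Prod.snd_add, Prod.smul_fst, Prod.smul_snd,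
    HoloCircle.geOne_add _ _ hz, HoloCircle.leZero_add _ _ hz, HoloCircle.geOne_smul,
    HoloCircle.leZero_smul, smul_eq_mul]

theorem hasDerivAt_lamSigma (σ : ℂ) (P : Point) (X : Tangent) {z : ℂ}
    (hz : z ∈ Metric.sphere (0 : ℂ) 1) :
    HasDerivAt (fun t : ℂ => lamSigma σ (P + t • X) z) (dLamSigma σ P z X) 0 := by
  simp only [lamSigma_add_smul σ P X _ hz]
  have hlin : ∀ a b : ℂ, HasDerivAt (fun t : ℂ => a + t * b) b 0 := fun a b => by
    simpa using ((hasDerivAt_id (0 : ℂ)).mul_const b).const_add a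
  have hexp : HasDerivAt (fun t : ℂ => exp (P.2.2 + t * X.2.2)) (exp P.2.2 * X.2.2) 0 := by
    simpa using (hlin P.2.2 X.2.2).cexp
  have h1 := ((((hlin (P.1.geOne z) (X.1.geOne z)).sub_const z).add (hlin P.2.1 X.2.1)).add
    (hexp.mul_const z⁻¹)).const_mul σ
  have h2 := ((((hlin (P.1.leZero z) (X.1.leZero z)).add_const z).sub (hlin P.2.1 X.2.1)).sub
    (hexp.mul_const z⁻¹)).const_mul (σ - 1)
  exact h1.add h2

theorem hasDerivAt_yInt (σ ℓ : ℂ) (P : Point) (X : Tangent) :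
    HasDerivAt (fun t : ℂ => yInt σ ℓ (P + t • X)) (dy σ ℓ P X) 0 := by
  have hmem : ∀ θ : ℝ, circleMap 0 1 θ ∈ Metric.sphere (0 : ℂ) 1 :=
    fun θ => circleMap_mem_sphere 0 zero_le_one θ
  have hG : ∀ Y : HoloCircle, Continuous fun θ : ℝ => Y.geOne (circleMap 0 1 θ) := fun Y =>
    Y.geOne_continuousOn.comp_continuous (continuous_circleMap 0 1) hmem
  have hL : ∀ Y : HoloCircle, Continuous fun θ : ℝ => Y.leZero (circleMap 0 1 θ) := fun Y =>
    Y.leZero_continuousOn.comp_continuous (continuous_circleMap 0 1) hmem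
  have hI : Continuous fun θ : ℝ => (circleMap 0 1 θ)⁻¹ :=
    (continuous_circleMap 0 1).inv₀ fun θ => HoloCircle.sphere_ne_zero (hmem θ)
  have hC := continuous_circleMap 0 1
  have key := hasDerivAt_intervalIntegral_of_holomorphic
    (f := fun t θ => deriv (circleMap 0 1) θ •
      (exp (exp ℓ * lamSigma σ (P + t • X) (circleMap 0 1 θ)) * (circleMap 0 1 θ)⁻¹))
    (a := 0) (b := 2 * π) (U := Set.univ) isOpen_univ ?_ ?_ (Set.mem_univ 0)
  · have h := (key.const_mul ((2 * π * I)⁻¹)).const_mul (exp (-(ℓ / 2)))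
    refine h.congr_deriv ?_
    have hd : ∀ θ : ℝ, deriv (fun t : ℂ => deriv (circleMap 0 1) θ •
        (exp (exp ℓ * lamSigma σ (P + t • X) (circleMap 0 1 θ)) * (circleMap 0 1 θ)⁻¹)) 0 =
        exp ℓ * (deriv (circleMap 0 1) θ • (exp (exp ℓ * lamSigma σ P (circleMap 0 1 θ)) *
          dLamSigma σ P (circleMap 0 1 θ) X * (circleMap 0 1 θ)⁻¹)) := by
      intro θ
      have h1 := ((((hasDerivAt_lamSigma σ P X (hmem θ)).const_mul (exp ℓ)).cexp.mul_const
        (circleMap 0 1 θ)⁻¹).const_smul (deriv (circleMap 0 1) θ)).deriv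
      refine h1.trans ?_
      simp only [smul_eq_mul, zero_smul, add_zero]
      ring
    simp only [hd]
    rw [intervalIntegral.integral_const_mul]
    change _ = exp (ℓ / 2) * ((2 * π * I)⁻¹ * ∫ θ in 0..(2 * π), _)
    -- The chain rule brings down a factor `ζ`, which turns `ζ^{-1/2}` into `ζ^{1/2}`.
    rw [mul_left_comm _ (exp ℓ), ← mul_assoc, ← exp_add]
    congr 2
    ring
  · refine Continuous.continuousOn ?_
    have hg := fun Y => (hG Y).comp (continuous_snd (X := ℂ))
    have hl := fun Y => (hL Y).comp (continuous_snd (X := ℂ))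
    have hi := hI.comp (continuous_snd (X := ℂ))
    have hc := hC.comp (continuous_snd (X := ℂ))
    have hg1 := hg P.1
    have hg2 := hg X.1
    have hl1 := hl P.1
    have hl2 := hl X.1
    simp only [Function.comp_def] at hg1 hg2 hl1 hl2 hi hc
    simp only [lamSigma_add_smul σ P X _ (hmem _), deriv_circleMap]
    fun_prop
  · intro θ _
    simp only [lamSigma_add_smul σ P X _ (hmem _)]
    fun_prop

/-! ### Coefficients of the integral solution -/

theorem dy_specialPoint (σ ℓ v u : ℂ) (X : Tangent) :
    dy σ ℓ (specialPoint v u) X = exp (ℓ / 2) * (exp (exp ℓ * v) * ((2 * π * I)⁻¹ *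
      ∮ z in C(0, 1), exp (exp ℓ * (σ - 1) * z + exp ℓ * exp u * z⁻¹) *
        dLamSigma σ (specialPoint v u) z X * z⁻¹)) := by
  change exp (ℓ / 2) * ((2 * π * I)⁻¹ * _) = _
  congr 1
  rw [mul_left_comm (exp (exp ℓ * v)), ← circleIntegral.integral_const_mul (exp (exp ℓ * v))]
  congr 1
  refine circleIntegral.integral_congr zero_le_one fun z hz => ?_
  simp only [lamSigma_specialPoint, mul_add, exp_add]
  ring_nf

/-- The coefficients are those of the generating function of `I_m(w)` after rescaling `z` by `p`.
With `w = 2 ζ eᵘ/p` they equal `ζ (σ(p) - 1)` and `ζ eᵘ`. -/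
theorem circleIntegral_besselI {p w : ℂ} (hp : p ≠ 0) (hw : w ≠ 0) (m : ℤ) :
    (2 * π * I)⁻¹ * (∮ z in C(0, 1), exp (w / (2 * p) * z + p * w / 2 * z⁻¹) * z ^ m * z⁻¹) =
      p ^ m * besselI m w := by
  rw [circleIntegral_exp (by simp [hp, hw]), inv_mul_cancel_left₀ two_pi_I_ne_zero, besselI,
    ← tsum_mul_left]
  refine tsum_congr fun k => ?_
  have h : (w / (2 * p)) ^ k * (p * w / 2) ^ ((k : ℤ) + m) =
      p ^ m * (w / 2) ^ (2 * (k : ℤ) + m) := by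
    have hw2 : w / 2 ≠ 0 := by simp [hw]
    have h1 : w / (2 * p) = w / 2 * p⁻¹ := by field_simp
    have h2 : p * w / 2 = w / 2 * p := by ring
    rw [h1, h2, mul_pow, mul_zpow, ← zpow_natCast, ← zpow_natCast, zpow_add₀ hp, inv_zpow,
      show 2 * (k : ℤ) + m = k + (k + m) by ring, zpow_add₀ hw2 k (k + m)]
    have := zpow_ne_zero k hp
    field_simp
  rw [h, mul_div_assoc]

/-- The term `k = 0` of `I_{-1}` sits at a pole of `Gamma` and vanishes; the rest is `I_1` after an
index shift. It is needed because `e_u` pairs with `z⁻¹`. -/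
theorem besselI_neg_one (w : ℂ) : besselI (-1) w = besselI 1 w := by
  rw [besselI, (tsum_eq_zero_add' ?_), besselI]
  · simp only [Nat.cast_zero, zero_add, Int.cast_neg, Int.cast_one, neg_add_cancel, Gamma_zero,
      zero_mul, div_zero]
    refine tsum_congr fun k => ?_
    have h1 : ((k + 1 : ℕ) : ℂ) + -1 + 1 = (k : ℂ) + 1 := by push_cast; ring
    have h2 : (k : ℂ) + 1 + 1 = ((k + 1 : ℕ) : ℂ) + 1 := by push_cast; ring
    rw [h1, h2, Gamma_nat_eq_factorial, Gamma_nat_eq_factorial]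
    congr 1
    · congr 1
      push_cast
      ring
    · ring
  · refine Summable.of_norm_bounded ((summable_pow_div_factorial (‖w / 2‖ ^ 2)).mul_left ‖w / 2‖)
      fun k => ?_
    have h1 : ((k + 1 : ℕ) : ℂ) + ((-1 : ℤ) : ℂ) + 1 = (k : ℂ) + 1 := by push_cast; ring
    rw [h1, Gamma_nat_eq_factorial]
    have h2 : (w / 2) ^ (2 * ((k + 1 : ℕ) : ℤ) + -1) = (w / 2) * ((w / 2) ^ 2) ^ k := by
      rw [← pow_mul, ← pow_succ', ← zpow_natCast]
      congr 1
      push_cast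
      ring
    rw [h2, norm_div, norm_mul, norm_mul, norm_pow, norm_pow, norm_natCast, norm_natCast,
      mul_div_assoc]
    have h3 : (1 : ℝ) ≤ ((k + 1).factorial : ℝ) := by exact_mod_cast Nat.factorial_pos _
    have h4 : (0 : ℝ) < (k.factorial : ℝ) := by exact_mod_cast Nat.factorial_pos _
    gcongr
    nlinarith

theorem testIncl_eZ (m : ℤ) : testIncl (eZ m) = (HoloCircle.monomial m, 0, 0) := by
  have : laurentToHolo (LaurentPolynomial.T m) = HoloCircle.monomial m := by
    simp only [laurentToHolo, LinearMap.comp_apply]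
    change Finsupp.linearCombination ℂ HoloCircle.monomial (Finsupp.single m 1) = _
    simp
  simp [testIncl, eZ, this]

theorem testIncl_eV : testIncl eV = (0, 1, 0) := by
  simp [testIncl, eV]

theorem testIncl_eU : testIncl eU = (0, 0, 1) := by
  simp [testIncl, eU]

section Coefficients

variable (v u ℓ : ℂ) {p : ℂ}

theorem circleIntegral_special (hp : p ≠ 0) (m : ℤ) :
    (2 * π * I)⁻¹ * (∮ z in C(0, 1), exp (exp ℓ * (1 + exp u / p ^ 2 - 1) * z +
      exp ℓ * exp u * z⁻¹) * z ^ m * z⁻¹) = p ^ m * besselI m (exp ℓ * (2 * exp u / p)) := by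
  rw [← circleIntegral_besselI hp (by simp [hp])]
  congr 2
  funext z
  congr 4 <;> field_simp
  ring

theorem dy_eZ (hp : p ≠ 0) (m : ℤ) :
    dy (1 + exp u / p ^ 2) ℓ (specialPoint v u) (testIncl (eZ m)) =
      (if 1 ≤ m then 1 + exp u / p ^ 2 else 1 + exp u / p ^ 2 - 1) * exp (ℓ / 2) *
        exp (exp ℓ * v) * p ^ m * besselI m (exp ℓ * (2 * exp u / p)) := by
  rw [dy_specialPoint, testIncl_eZ]
  set σ := 1 + exp u / p ^ 2 with hσ
  have h : (∮ z in C(0, 1), exp (exp ℓ * (σ - 1) * z + exp ℓ * exp u * z⁻¹) *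
      dLamSigma σ (specialPoint v u) z (HoloCircle.monomial m, 0, 0) * z⁻¹) =
      (if 1 ≤ m then σ else σ - 1) * ∮ z in C(0, 1),
        exp (exp ℓ * (σ - 1) * z + exp ℓ * exp u * z⁻¹) * z ^ m * z⁻¹ := by
    rw [← circleIntegral.integral_const_mul]
    congr 1
    funext z
    simp only [dLamSigma, dLamBar, dLam, HoloCircle.geOne_monomial, HoloCircle.leZero_monomial]
    split_ifs <;> ring
  rw [h, mul_left_comm (2 * π * I : ℂ)⁻¹, circleIntegral_special u ℓ hp]
  ring

theorem dy_eV (hp : p ≠ 0) :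
    dy (1 + exp u / p ^ 2) ℓ (specialPoint v u) (testIncl eV) =
      exp (ℓ / 2) * exp (exp ℓ * v) * besselI 0 (exp ℓ * (2 * exp u / p)) := by
  have h0 := circleIntegral_special u ℓ hp 0
  rw [zpow_zero, one_mul] at h0
  rw [dy_specialPoint, testIncl_eV, mul_assoc (exp (ℓ / 2)), ← h0]
  congr 5
  funext z
  simp only [dLamSigma, dLamBar, dLam, HoloCircle.geOne_zero, HoloCircle.leZero_zero, zpow_zero]
  ring

theorem dy_eU (hp : p ≠ 0) :
    dy (1 + exp u / p ^ 2) ℓ (specialPoint v u) (testIncl eU) =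
      exp u / p * exp (ℓ / 2) * exp (exp ℓ * v) * besselI 1 (exp ℓ * (2 * exp u / p)) := by
  have h0 := circleIntegral_special u ℓ hp (-1)
  rw [besselI_neg_one, zpow_neg_one] at h0
  have h : ∀ σ : ℂ, (∮ z in C(0, 1), exp (exp ℓ * (σ - 1) * z + exp ℓ * exp u * z⁻¹) *
      dLamSigma σ (specialPoint v u) z (0, 0, 1) * z⁻¹) =
      exp u * ∮ z in C(0, 1),
        exp (exp ℓ * (σ - 1) * z + exp ℓ * exp u * z⁻¹) * z ^ (-1 : ℤ) * z⁻¹ := by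
    intro σ
    rw [← circleIntegral.integral_const_mul]
    congr 1
    funext z
    simp only [dLamSigma, dLamBar, dLam, HoloCircle.geOne_zero, HoloCircle.leZero_zero,
      specialPoint, zpow_neg_one]
    ring
  rw [dy_specialPoint, testIncl_eU, h, mul_left_comm (2 * π * I : ℂ)⁻¹, h0]
  ring

end Coefficients

/-! ### Representability -/

namespace HoloCircle

theorem geOne_analyticOnNhd (f : HoloCircle) :
    AnalyticOnNhd ℂ f.geOne (Metric.sphere (0 : ℂ) 1) := by
  obtain ⟨r, h0, h1, M, hM⟩ := exists_coeff_bound f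
  -- Any radius strictly between `1` and `1 / r` would do: the series still converges geometrically
  -- there.
  have hR : 1 < 2 / (1 + r) := by rw [lt_div_iff₀ (by linarith)]; linarith
  have hrR : r * (2 / (1 + r)) < 1 := by
    rw [← mul_div_assoc, div_lt_one (by linarith)]; linarith
  have hd : DifferentiableOn ℂ f.geOne (Metric.ball 0 (2 / (1 + r))) := by
    refine differentiableOn_tsum_of_summable_norm
      (u := fun k => M * (r * (2 / (1 + r))) ^ (k + 1)) ?_ (fun k => by fun_prop)
      Metric.isOpen_ball fun k z hz => ?_
    · exact ((summable_nat_add_iff 1).2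
        (summable_geometric_of_lt_one (by positivity) hrR)).mul_left M
    · rw [mem_ball_zero_iff] at hz
      have := (hM (k + 1)).1
      push_cast at this
      rw [norm_mul, norm_pow, mul_pow, ← mul_assoc]
      gcongr
      exact (norm_nonneg _).trans this
  refine (hd.analyticOnNhd Metric.isOpen_ball).mono fun z hz => ?_
  rw [mem_sphere_zero_iff_norm] at hz
  rw [mem_ball_zero_iff, hz]
  exact hR

theorem leZero_analyticOnNhd (f : HoloCircle) :
    AnalyticOnNhd ℂ f.leZero (Metric.sphere (0 : ℂ) 1) := by
  obtain ⟨r, h0, h1, M, hM⟩ := exists_coeff_bound f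
  -- The midpoint of `r` and `1`: outside this radius the series in `z⁻¹` converges geometrically.
  have hR : (1 + r) / 2 < 1 := by linarith
  have hrR : r * ((1 + r) / 2)⁻¹ < 1 := by
    rw [← div_eq_mul_inv, div_lt_one (by linarith)]; linarith
  have hU : IsOpen {z : ℂ | (1 + r) / 2 < ‖z‖} := isOpen_lt continuous_const continuous_norm
  have hd : DifferentiableOn ℂ f.leZero {z : ℂ | (1 + r) / 2 < ‖z‖} := by
    refine differentiableOn_tsum_of_summable_norm
      (u := fun k => M * (r * ((1 + r) / 2)⁻¹) ^ k) ?_ (fun k z hz => ?_) hU fun k z hz => ?_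
    · exact (summable_geometric_of_lt_one (by positivity) hrR).mul_left M
    · have hz0 : z ≠ 0 := norm_pos_iff.1 (lt_trans (by linarith) hz)
      exact ((((differentiableAt_inv hz0).pow k).const_mul _)).differentiableWithinAt
    · have hz' : (1 + r) / 2 < ‖z‖ := hz
      have := (hM k).2
      rw [norm_mul, norm_pow, norm_inv, mul_pow, ← mul_assoc]
      gcongr
      exact (norm_nonneg _).trans this
  refine (hd.analyticOnNhd hU).mono fun z hz => ?_
  rw [mem_sphere_zero_iff_norm] at hz
  rw [Set.mem_ofPred_eq, hz]
  exact hR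

/-- The projection `f_{≥ 1}` as an element of `ℋ(S¹)`. -/
def geOneHolo (f : HoloCircle) : HoloCircle :=
  ⟨fun z => f.geOne z, f.geOne, f.geOne_analyticOnNhd, fun _ => rfl⟩

/-- The projection `f_{≤ 0}` as an element of `ℋ(S¹)`. -/
def leZeroHolo (f : HoloCircle) : HoloCircle :=
  ⟨fun z => f.leZero z, f.leZero, f.leZero_analyticOnNhd, fun _ => rfl⟩

theorem extension_geOneHolo (f : HoloCircle) {z : ℂ} (hz : z ∈ Metric.sphere (0 : ℂ) 1) :
    f.geOneHolo.extension z = f.geOne z :=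
  extension_eq f.geOneHolo ⟨z, hz⟩

theorem extension_leZeroHolo (f : HoloCircle) {z : ℂ} (hz : z ∈ Metric.sphere (0 : ℂ) 1) :
    f.leZeroHolo.extension z = f.leZero z :=
  extension_eq f.leZeroHolo ⟨z, hz⟩

theorem exists_norm_extension_le (f : HoloCircle) :
    ∃ M : ℝ, 0 ≤ M ∧ ∀ z ∈ Metric.sphere (0 : ℂ) 1, ‖f.extension z‖ ≤ M := by
  obtain ⟨M, hM⟩ := (isCompact_sphere (0 : ℂ) 1).exists_bound_of_continuousOn
    f.extension_analytic.continuousOn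
  exact ⟨M, (norm_nonneg _).trans (hM 1 (by simp)), hM⟩

/-- With respect to the residue pairing `(1 / 2πi) ∮ f g dz / z²`, the projections `f ↦ f_{≥ 1}`
and `f ↦ f_{≤ 0}` are adjoint to each other. -/
theorem circleIntegral_geOne_mul (f g : HoloCircle) :
    (∮ z in C(0, 1), f.extension z * g.geOne z * z⁻¹ * z⁻¹) =
      ∮ z in C(0, 1), f.leZero z * g.extension z * z⁻¹ * z⁻¹ := by
  obtain ⟨b, hb, hb1, -⟩ := summable_bound g
  obtain ⟨c, hc, -, hc2⟩ := summable_bound f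
  obtain ⟨M, hM0, hM⟩ := exists_norm_extension_le f
  obtain ⟨N, hN0, hN⟩ := exists_norm_extension_le g
  have hf := f.extension_analytic.continuousOn
  have hg := g.extension_analytic.continuousOn
  have hi := continuousOn_inv_sphere
  have hnorm : ∀ z ∈ Metric.sphere (0 : ℂ) 1, ‖z⁻¹‖ = 1 := fun z hz => by
    rw [mem_sphere_zero_iff_norm] at hz
    rw [norm_inv, hz, inv_one]
  have h1 := hasSum_circleIntegral
    (f := fun k z => f.extension z * (g.coeff (k + 1) * z ^ (k + 1)) * z⁻¹ * z⁻¹)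
    (g := fun z => f.extension z * g.geOne z * z⁻¹ * z⁻¹) (b := fun k => M * b k)
    (fun k => by fun_prop) (hb.mul_left M) (fun k z hz => by
      rw [norm_mul, norm_mul, norm_mul, hnorm z hz, mul_one, mul_one]
      exact mul_le_mul (hM z hz) (hb1 k z hz) (norm_nonneg _) hM0)
    (fun z hz => (((Summable.of_norm_bounded hb fun k => hb1 k z hz).hasSum.mul_left
      _).mul_right _).mul_right _)
  have h2 := hasSum_circleIntegral
    (f := fun k z => f.coeff (-k) * z⁻¹ ^ k * g.extension z * z⁻¹ * z⁻¹)
    (g := fun z => f.leZero z * g.extension z * z⁻¹ * z⁻¹) (b := fun k => c k * N)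
    (fun k => by fun_prop) (hc.mul_right N) (fun k z hz => by
      rw [norm_mul, norm_mul, norm_mul, hnorm z hz, mul_one, mul_one]
      exact mul_le_mul (hc2 k z hz) (hN z hz) (norm_nonneg _)
        ((norm_nonneg _).trans (hc2 k z hz)))
    (fun z hz => (((Summable.of_norm_bounded hc fun k => hc2 k z hz).hasSum.mul_right
      _).mul_right _).mul_right _)
  -- Both `k`-th terms equal `2 π i f_{-k} g_{k+1}`: a product `zᵃ zᵇ z⁻²` has a residue exactly
  -- when `a + b = 1`, which matches `a ≤ 0` with `b ≥ 1`.
  have hterm : ∀ k : ℕ,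
      (∮ z in C(0, 1), f.extension z * (g.coeff (k + 1) * z ^ (k + 1)) * z⁻¹ * z⁻¹) =
        ∮ z in C(0, 1), f.coeff (-k) * z⁻¹ ^ k * g.extension z * z⁻¹ * z⁻¹ := by
    intro k
    have e1 : (∮ z in C(0, 1), f.extension z * (g.coeff (k + 1) * z ^ (k + 1)) * z⁻¹ * z⁻¹) =
        g.coeff (k + 1) * ∮ z in C(0, 1), f.extension z * z ^ (-(-k : ℤ)) * z⁻¹ := by
      rw [← circleIntegral.integral_const_mul]
      refine circleIntegral.integral_congr zero_le_one fun z hz => ?_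
      have hz0 := sphere_ne_zero hz
      simp only [neg_neg, zpow_natCast, pow_succ]
      field_simp
    have e2 : (∮ z in C(0, 1), f.coeff (-k) * z⁻¹ ^ k * g.extension z * z⁻¹ * z⁻¹) =
        f.coeff (-k) * ∮ z in C(0, 1), g.extension z * z ^ (-(k + 1 : ℤ)) * z⁻¹ := by
      rw [← circleIntegral.integral_const_mul]
      refine circleIntegral.integral_congr zero_le_one fun z hz => ?_
      have hz0 := sphere_ne_zero hz
      simp only [neg_add, zpow_add₀ hz0, zpow_neg, zpow_natCast, zpow_one, inv_pow]
      ring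
    rw [e1, e2]
    simp only [coeff]
    ring
  rw [funext hterm] at h1
  exact h1.unique h2

end HoloCircle

theorem isRepresentable_dy (σ ℓ v u : ℂ) :
    IsRepresentable (specialPoint v u) (dy σ ℓ (specialPoint v u)) := by
  set G : ℂ → ℂ := fun z => exp (exp ℓ * lamSigma σ (specialPoint v u) z) with hG
  have hGan : AnalyticOnNhd ℂ G (Metric.sphere 0 1) := by
    intro z hz
    have hz0 := HoloCircle.sphere_ne_zero hz
    simp only [hG, lamSigma_specialPoint]
    have : AnalyticAt ℂ (fun z : ℂ => z⁻¹) z := analyticAt_inv hz0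
    fun_prop
  -- The extra factor `z` converts the measure `dz/z` of the integral solution into the `dz/z²` of
  -- the metric, since `w' = 1` here.
  let H : HoloCircle := ⟨fun z => z * G z, fun z => z * G z, analyticOnNhd_id.mul hGan,
    fun _ => rfl⟩
  have hH : ∀ z ∈ Metric.sphere (0 : ℂ) 1, H.extension z = z * G z :=
    fun z hz => HoloCircle.extension_eq H ⟨z, hz⟩
  have hGc := hGan.continuousOn
  have hi := continuousOn_inv_sphere
  -- Adjointness exchanges the projections: `σ` multiplies `X_{≥ 1}` in `dλ_σ` but `H_{≤ 0}` here.
  -- Likewise the metric pairs `v` with `u`, so the `v`-component holds the coefficient of `X_u` and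
  -- conversely.
  refine ⟨(exp (ℓ / 2) • (σ • H.leZeroHolo + (σ - 1) • H.geOneHolo),
    exp (ℓ / 2) * exp u * ((2 * π * I)⁻¹ * ∮ z in C(0, 1), G z * z⁻¹ * z⁻¹),
    exp (ℓ / 2) * ((2 * π * I)⁻¹ * ∮ z in C(0, 1), G z * z⁻¹)), fun X => ?_⟩
  have hXg := X.1.geOne_continuousOn
  have hXl := X.1.leZero_continuousOn
  have hX := X.1.extension_analytic.continuousOn
  have hHc := H.extension_analytic.continuousOn
  have hHg := H.geOne_continuousOn
  have hHl := H.leZero_continuousOn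
  have hint : ∀ {g : ℂ → ℂ}, ContinuousOn g (Metric.sphere (0 : ℂ) 1) → CircleIntegrable g 0 1 :=
    fun h => h.circleIntegrable zero_le_one
  have e1 : (∮ z in C(0, 1), G z * dLamSigma σ (specialPoint v u) z X * z⁻¹) =
      σ * (∮ z in C(0, 1), H.extension z * X.1.geOne z * z⁻¹ * z⁻¹) +
      (σ - 1) * (∮ z in C(0, 1), X.1.leZero z * H.extension z * z⁻¹ * z⁻¹) +
      X.2.1 * (∮ z in C(0, 1), G z * z⁻¹) +
      exp u * X.2.2 * (∮ z in C(0, 1), G z * z⁻¹ * z⁻¹) := by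
    simp only [← circleIntegral.integral_const_mul]
    rw [← circleIntegral.integral_add (hint (by fun_prop)) (hint (by fun_prop)),
      ← circleIntegral.integral_add (hint (by fun_prop)) (hint (by fun_prop)),
      ← circleIntegral.integral_add (hint (by fun_prop)) (hint (by fun_prop))]
    refine circleIntegral.integral_congr zero_le_one fun z hz => ?_
    have hz0 := HoloCircle.sphere_ne_zero hz
    simp only [hH z hz, dLamSigma, dLam, dLamBar, specialPoint]
    field_simp
    ring
  have e2 : (∮ z in C(0, 1),
      (exp (ℓ / 2) • (σ • H.leZeroHolo + (σ - 1) • H.geOneHolo)).extension z *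
        X.1.extension z / z ^ 2) =
      exp (ℓ / 2) * (σ * (∮ z in C(0, 1), H.leZero z * X.1.extension z * z⁻¹ * z⁻¹) +
      (σ - 1) * (∮ z in C(0, 1), X.1.extension z * H.geOne z * z⁻¹ * z⁻¹)) := by
    rw [← circleIntegral.integral_const_mul σ, ← circleIntegral.integral_const_mul (σ - 1),
      ← circleIntegral.integral_add (hint (by fun_prop)) (hint (by fun_prop)),
      ← circleIntegral.integral_const_mul]
    refine circleIntegral.integral_congr zero_le_one fun z hz => ?_
    simp only [HoloCircle.extension_smul _ _ hz, HoloCircle.extension_add _ _ hz,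
      HoloCircle.extension_geOneHolo _ hz, HoloCircle.extension_leZeroHolo _ hz]
    ring
  rw [metric_specialPoint, e2]
  change exp (ℓ / 2) * ((2 * π * I)⁻¹ * _) = _
  rw [e1, HoloCircle.circleIntegral_geOne_mul, ← HoloCircle.circleIntegral_geOne_mul X.1]
  ring

/-! ### The coefficients of the formal solutions -/

/-- The product `(1/2 + m)_k (1/2 - m)_k` of Pochhammer symbols. -/
def halfPoch (m : ℤ) (k : ℕ) : ℂ := ∏ j ∈ Finset.range k, (((j : ℂ) + 1 / 2) ^ 2 - (m : ℂ) ^ 2)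

theorem halfPoch_zero (m : ℤ) : halfPoch m 0 = 1 := by simp [halfPoch]

theorem halfPoch_succ (m : ℤ) (k : ℕ) :
    halfPoch m (k + 1) = halfPoch m k * (((k : ℂ) + 1 / 2) ^ 2 - (m : ℂ) ^ 2) :=
  Finset.prod_range_succ _ _

theorem halfPoch_neg (m : ℤ) (k : ℕ) : halfPoch (-m) k = halfPoch m k := by
  simp [halfPoch]

theorem halfPoch_natAbs (m : ℤ) (k : ℕ) : halfPoch (m.natAbs : ℤ) k = halfPoch m k := by
  rcases Int.natAbs_eq m with h | h
  · rw [← h]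
  · rw [← halfPoch_neg, ← h]

/-- Up to the sign `(-1)^k`, `halfPoch m k` is the product of the `2k` consecutive half-integers
centred at `m`. Raising both `m` and `k` keeps the lower end and adds two factors at the top. -/
theorem halfPoch_add_one (m : ℤ) (k : ℕ) : halfPoch (m + 1) (k + 1) =
    -halfPoch m k * (m + k + 1 / 2) * (m + k + 3 / 2) := by
  induction k with
  | zero =>
    rw [halfPoch_succ, halfPoch_zero, halfPoch_zero]
    push_cast
    ring
  | succ k ih =>
    rw [halfPoch_succ, ih, halfPoch_succ m k]
    push_cast
    ring

theorem halfPoch_sub_one (m : ℤ) (k : ℕ) : halfPoch (m - 1) (k + 1) =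
    -halfPoch m k * (m - k - 1 / 2) * (m - k - 3 / 2) := by
  have h := halfPoch_add_one (-m) k
  rw [halfPoch_neg, show -m + 1 = -(m - 1) by ring, halfPoch_neg] at h
  rw [h]
  push_cast
  ring

/-- The Pochhammer symbol `(1/2)_k`. -/
def poch (k : ℕ) : ℂ := ∏ j ∈ Finset.range k, ((j : ℂ) + 1 / 2)

theorem poch_zero : poch 0 = 1 := by simp [poch]

theorem poch_succ (k : ℕ) : poch (k + 1) = poch k * ((k : ℂ) + 1 / 2) :=
  Finset.prod_range_succ _ _

theorem natCast_add_half_ne_zero (k : ℕ) : (k : ℂ) + 1 / 2 ≠ 0 := by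
  intro h
  have := congrArg re h
  simp at this
  linarith [(Nat.cast_nonneg k : (0 : ℝ) ≤ k)]

theorem poch_ne_zero (k : ℕ) : poch k ≠ 0 :=
  Finset.prod_ne_zero_iff.2 fun j _ => natCast_add_half_ne_zero j

theorem factorial_ne_zero' (k : ℕ) : (k.factorial : ℂ) ≠ 0 :=
  Nat.cast_ne_zero.2 k.factorial_ne_zero

theorem inv_Gamma_half_sub (k : ℕ) :
    (Gamma (1 / 2 - (k : ℂ)))⁻¹ = (-1) ^ k * poch k * ((√π : ℝ) : ℂ)⁻¹ := by
  induction k with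
  | zero =>
    have : Gamma (1 / 2 : ℂ) = ((√π : ℝ) : ℂ) := by
      rw [← Real.Gamma_one_half_eq, ← Gamma_ofReal]
      push_cast
      rfl
    rw [pow_zero, poch_zero, Nat.cast_zero, sub_zero, this, one_mul, one_mul]
  | succ k ih =>
    have hs : (1 / 2 - ((k + 1 : ℕ) : ℂ)) ≠ 0 := by
      have := natCast_add_half_ne_zero k
      intro h
      apply this
      push_cast at h
      linear_combination -h
    have h := Gamma_add_one _ hs
    rw [show (1 / 2 - ((k + 1 : ℕ) : ℂ)) + 1 = 1 / 2 - (k : ℂ) by push_cast; ring] at h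
    rw [h, mul_inv, inv_mul_eq_iff_eq_mul₀ hs] at ih
    rw [ih, poch_succ]
    push_cast
    ring

theorem choose_eq_prod (a : ℂ) (n : ℕ) :
    Ring.choose a n = (n.factorial : ℂ)⁻¹ * ∏ j ∈ Finset.range n, (a - j) := by
  rw [eq_inv_mul_iff_mul_eq₀ (factorial_ne_zero' n), ← nsmul_eq_mul,
    ← Ring.descPochhammer_eq_factorial_smul_choose]
  induction n with
  | zero => simp
  | succ n ih =>
    rw [Finset.prod_range_succ, ← ih, descPochhammer_succ_right]
    simp [Polynomial.smeval_mul, Polynomial.smeval_natCast]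

theorem choose_eq_halfPoch (m : ℤ) (k : ℕ) :
    Ring.choose ((m : ℂ) + k - 1 / 2) (2 * k) =
      (-1) ^ k * halfPoch m k / ((2 * k).factorial : ℂ) := by
  have h : ∏ j ∈ Finset.range (2 * k), ((m : ℂ) + k - 1 / 2 - j) = (-1) ^ k * halfPoch m k := by
    induction k with
    | zero => simp [halfPoch_zero]
    | succ k ih =>
      -- Removing the two extreme factors `m ± (k + 1/2)` leaves the product for `k`.
      rw [show 2 * (k + 1) = 2 * k + 1 + 1 by ring, Finset.prod_range_succ,
        Finset.prod_range_succ']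
      have : ∏ j ∈ Finset.range (2 * k), ((m : ℂ) + ((k + 1 : ℕ) : ℂ) - 1 / 2 - ((j + 1 : ℕ) : ℂ)) =
          (-1) ^ k * halfPoch m k := by
        rw [← ih]
        refine Finset.prod_congr rfl fun j _ => ?_
        push_cast
        ring
      rw [this, halfPoch_succ]
      push_cast
      ring
  rw [choose_eq_prod, h]
  ring

theorem factorial_two_mul (k : ℕ) :
    ((2 * k).factorial : ℂ) = 4 ^ k * (k.factorial : ℂ) * poch k := by
  induction k with
  | zero => simp [poch_zero]
  | succ k ih =>
    rw [show 2 * (k + 1) = 2 * k + 1 + 1 by ring, Nat.factorial_succ, Nat.factorial_succ,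
      Nat.factorial_succ, poch_succ]
    push_cast
    rw [ih]
    ring

/-- The signs from `1/Γ(1/2 - k)` and from the binomial cancel, and `(2k)! = 4ᵏ k! (1/2)_k` removes
the remaining Pochhammer symbol. The `4ᵏ` places the singularity of the Borel transform at `4 eᵘ/p`.
-/
theorem phiCoeff_eq (u p : ℂ) (m : ℤ) (k : ℕ) : phiCoeff u p m k =
    ((√π : ℝ) : ℂ)⁻¹ * (halfPoch m k / (k.factorial : ℂ)) * (p / (4 * exp u)) ^ k := by
  rw [phiCoeff, inv_Gamma_half_sub, choose_eq_halfPoch, factorial_two_mul, mul_comm (4 : ℂ),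
    ← div_div p, div_pow _ (4 : ℂ)]
  have h1 := poch_ne_zero k
  have h2 := factorial_ne_zero' k
  have h3 : ((-1 : ℂ) ^ k) * (-1) ^ k = 1 := by rw [← mul_pow]; simp
  field_simp
  linear_combination halfPoch m k * (p / exp u) ^ k * h3

/-! ### A generating function -/

/-- The function `T_m(1 - 2 y) / √(1 - y)`, where `T_m` is the Chebyshev polynomial. -/
def chebRoot (m : ℤ) (y : ℂ) : ℂ :=
  (Polynomial.Chebyshev.T ℂ m).eval (1 - 2 * y) * (1 - y) ^ (-(1 / 2) : ℂ)

/-- The Taylor coefficients of `chebRoot`. -/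
def chebRootCoeff (m : ℤ) (k : ℕ) : ℂ := halfPoch m k / ((k.factorial : ℂ) * poch k)

theorem chebRootCoeff_zero (m : ℤ) : chebRootCoeff m 0 = 1 := by
  simp [chebRootCoeff, halfPoch_zero, poch_zero]

/-- The Chebyshev recurrence `T_{m+1} + T_{m-1} = 2 (1 - 2y) T_m`, read on Taylor coefficients. -/
theorem chebRootCoeff_rec (m : ℤ) (k : ℕ) :
    chebRootCoeff (m + 1) (k + 1) + chebRootCoeff (m - 1) (k + 1) =
      2 * chebRootCoeff m (k + 1) - 4 * chebRootCoeff m k := by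
  have h1 := poch_ne_zero k
  have h2 := factorial_ne_zero' k
  have h3 := natCast_add_half_ne_zero k
  have h4 : (k : ℂ) + 1 ≠ 0 := by exact_mod_cast k.succ_ne_zero
  simp only [chebRootCoeff]
  rw [halfPoch_add_one, halfPoch_sub_one, halfPoch_succ, poch_succ, Nat.factorial_succ]
  have h5 : (k : ℂ) * 2 + 1 ≠ 0 := by
    intro h
    apply h3
    linear_combination h / 2
  push_cast
  field_simp
  ring

theorem hasSum_chebRoot_zero {y : ℂ} (hy : ‖y‖ < 1) :
    HasSum (fun k => chebRootCoeff 0 k * y ^ k) (chebRoot 0 y) := by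
  have h := (one_add_cpow_hasFPowerSeriesOnBall_zero (a := -(1 / 2))).hasSum (y := -y) (by
    rw [← ENNReal.ofReal_one, Metric.eball_ofReal]
    simpa using hy)
  simp only [zero_add] at h
  have h0 : chebRoot 0 y = (1 + -y) ^ (-(1 / 2) : ℂ) := by
    simp [chebRoot, sub_eq_add_neg]
  rw [h0]
  suffices hk : ∀ k, chebRootCoeff 0 k * y ^ k =
      binomialSeries ℂ (-(1 / 2) : ℂ) k fun _ => -y by
    simp only [hk]
    exact h
  intro k
  rw [binomialSeries_apply, choose_eq_prod]
  have : ∏ j ∈ Finset.range k, (-(1 / 2 : ℂ) - j) = (-1) ^ k * poch k := by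
    clear * -
    induction k with
    | zero => simp [poch_zero]
    | succ k ih =>
      rw [Finset.prod_range_succ, ih, poch_succ]
      ring
  have h2 : halfPoch 0 k = poch k * poch k := by
    rw [halfPoch, poch, ← Finset.prod_mul_distrib]
    refine Finset.prod_congr rfl fun j _ => ?_
    push_cast
    ring
  have h3 := poch_ne_zero k
  have h4 := factorial_ne_zero' k
  have h5 : ((-1 : ℂ) ^ k) * (-1) ^ k = 1 := by rw [← mul_pow]; simp
  rw [this, chebRootCoeff, h2, List.ofFn_const, List.prod_replicate, smul_eq_mul, neg_pow y]
  field_simp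
  linear_combination -y ^ k * h5

theorem hasSum_step {c c' c'' : ℕ → ℂ} {y s s' s'' : ℂ} (h0 : c'' 0 = 2 * c' 0 - c 0)
    (hrec : ∀ k, c'' (k + 1) = 2 * c' (k + 1) - 4 * c' k - c (k + 1))
    (hs : HasSum (fun k => c k * y ^ k) s) (hs' : HasSum (fun k => c' k * y ^ k) s')
    (hval : s'' = 2 * (1 - 2 * y) * s' - s) : HasSum (fun k => c'' k * y ^ k) s'' := by
  rw [← hasSum_nat_add_iff' 1] at hs ⊢
  have h1 := (((hasSum_nat_add_iff' 1).2 hs').mul_left 2).sub (hs'.mul_left (4 * y))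
  convert h1.sub hs using 1
  · funext k
    rw [hrec]
    ring
  · simp only [Finset.sum_range_one, pow_zero, mul_one, h0, hval]
    ring

theorem hasSum_chebRoot_nat (n : ℕ) {y : ℂ} (hy : ‖y‖ < 1) :
    HasSum (fun k => chebRootCoeff n k * y ^ k) (chebRoot n y) := by
  have h0 := hasSum_chebRoot_zero hy
  induction n using Nat.twoStepInduction with
  | zero => simpa using h0
  | one =>
    -- By evenness in `m`, the recurrence at `m = 0` alone determines the case `m = 1`.
    have hneg : ∀ k, chebRootCoeff (-1) k = chebRootCoeff 1 k := fun k => by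
      rw [chebRootCoeff, chebRootCoeff, halfPoch_neg]
    rw [← hasSum_nat_add_iff' 1]
    convert ((hasSum_nat_add_iff' 1).2 h0).sub (h0.mul_left (2 * y)) using 1
    · funext k
      have h := chebRootCoeff_rec 0 k
      rw [zero_add, zero_sub, hneg] at h
      push_cast
      linear_combination y ^ (k + 1) * h / 2
    · simp [chebRoot, chebRootCoeff_zero]
      ring
  | more n ih1 ih2 =>
    refine hasSum_step (by simp only [chebRootCoeff_zero]; norm_num) (fun k => ?_) ih1 ih2 ?_
    · have h := chebRootCoeff_rec (n + 1) k
      rw [add_sub_cancel_right, show (n : ℤ) + 1 + 1 = n + 2 by ring] at h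
      push_cast
      linear_combination h
    · simp only [chebRoot]
      push_cast
      rw [Polynomial.Chebyshev.T_add_two]
      simp
      ring

theorem hasSum_chebRoot (m : ℤ) {y : ℂ} (hy : ‖y‖ < 1) :
    HasSum (fun k => chebRootCoeff m k * y ^ k) (chebRoot m y) := by
  have h := hasSum_chebRoot_nat m.natAbs hy
  simp only [chebRootCoeff, halfPoch_natAbs, chebRoot, Polynomial.Chebyshev.T_natAbs] at h
  exact h

/-! ### The Borel transform -/

/-- The hypergeometric function `₂F₁(1/2 + m, 1/2 - m; 1; x)`, as an integral. -/
def hyp (m : ℤ) (x : ℂ) : ℂ :=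
  (2 * π : ℂ)⁻¹ * ∫ φ in (-π)..π, chebRoot m (x * (Real.sin φ ^ 2 : ℝ))

theorem integral_sin_pow_even_full (n : ℕ) :
    ((∫ φ in (-π)..π, Real.sin φ ^ (2 * n) : ℝ) : ℂ) =
      2 * π * (poch n / (n.factorial : ℂ)) := by
  have hint : ∀ a b : ℝ, IntervalIntegrable (fun φ => Real.sin φ ^ (2 * n)) volume a b :=
    fun a b => (by fun_prop : Continuous fun φ => Real.sin φ ^ (2 * n)).intervalIntegrable a b
  have hper : Function.Periodic (fun φ => Real.sin φ ^ (2 * n)) π := fun φ => by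
    simp [Real.sin_add_pi, pow_mul]
  have h1 := hper.intervalIntegral_add_eq (-π) 0
  rw [neg_add_cancel, zero_add] at h1
  rw [← intervalIntegral.integral_add_adjacent_intervals (hint (-π) 0) (hint 0 π), h1,
    integral_sin_pow_even]
  have : ((∏ i ∈ Finset.range n, (2 * (i : ℝ) + 1) / (2 * i + 2) : ℝ) : ℂ) =
      poch n / (n.factorial : ℂ) := by
    induction n with
    | zero => simp [poch_zero]
    | succ n ih =>
      rw [Finset.prod_range_succ, ofReal_mul, ih (fun a b =>
        (by fun_prop : Continuous fun φ => Real.sin φ ^ (2 * n)).intervalIntegrable a b)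
        (fun φ => by simp [Real.sin_add_pi, pow_mul]), poch_succ, Nat.factorial_succ]
      · have h2 := factorial_ne_zero' n
        have h4 : (n : ℂ) + 1 ≠ 0 := by exact_mod_cast n.succ_ne_zero
        push_cast
        field_simp
      · have hper' : Function.Periodic (fun φ => Real.sin φ ^ (2 * n)) π := fun φ => by
          simp [Real.sin_add_pi, pow_mul]
        simpa using hper'.intervalIntegral_add_eq (-π) 0
  push_cast at this ⊢
  rw [this]
  ring

theorem one_sub_mem_slitPlane {y : ℂ} (hy : y.re < 1) : 1 - y ∈ slitPlane :=
  Or.inl (by simpa using hy)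

theorem differentiableOn_chebRoot (m : ℤ) : DifferentiableOn ℂ (chebRoot m) {y | y.re < 1} := by
  intro y hy
  have h1 : DifferentiableAt ℂ (fun y : ℂ => (1 - y) ^ (-(1 / 2) : ℂ)) y :=
    (differentiableAt_id.const_sub 1).cpow_const (one_sub_mem_slitPlane hy)
  have h2 : DifferentiableAt ℂ
      (fun y : ℂ => (Polynomial.Chebyshev.T ℂ m).eval (1 - 2 * y)) y :=
    DifferentiableAt.comp y (g := fun z => (Polynomial.Chebyshev.T ℂ m).eval z)
      (f := fun y => 1 - 2 * y) (Polynomial.differentiable _).differentiableAt (by fun_prop)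
  exact (h2.mul h1).differentiableWithinAt

theorem re_mul_sin_sq_lt {x : ℂ} (hx : x.re < 1) (φ : ℝ) :
    (x * (Real.sin φ ^ 2 : ℝ)).re < 1 := by
  rw [re_mul_ofReal]
  rcases le_total x.re 0 with h | h
  · nlinarith [sq_nonneg (Real.sin φ)]
  · nlinarith [Real.sin_sq_le_one φ]

theorem isOpen_re_lt_one : IsOpen {x : ℂ | x.re < 1} := isOpen_lt continuous_re continuous_const

theorem continuousOn_chebRoot_mul_sin_sq (m : ℤ) :
    ContinuousOn (fun q : ℂ × ℝ => chebRoot m (q.1 * (Real.sin q.2 ^ 2 : ℝ)))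
      ({x | x.re < 1} ×ˢ Set.univ) := by
  refine (differentiableOn_chebRoot m).continuousOn.comp (by fun_prop) fun q hq => ?_
  exact re_mul_sin_sq_lt hq.1 q.2

/-- The integral continues the hypergeometric series beyond its disc, to a half-plane containing the
negative axis, where the Borel ray lies. -/
theorem differentiableOn_hyp (m : ℤ) : DifferentiableOn ℂ (hyp m) {x | x.re < 1} := by
  intro x hx
  have key := hasDerivAt_intervalIntegral_of_holomorphic (a := -π) (b := π)
    (f := fun x φ => chebRoot m (x * (Real.sin φ ^ 2 : ℝ))) isOpen_re_lt_one
    ((continuousOn_chebRoot_mul_sin_sq m).mono (Set.prod_mono subset_rfl (Set.subset_univ _)))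
    (fun φ _ => (differentiableOn_chebRoot m).comp (by fun_prop)
      fun y hy => re_mul_sin_sq_lt hy φ) hx
  exact (key.differentiableAt.const_mul _).differentiableWithinAt

/-- The mean of `sin^{2k}` is `(1/2)_k / k!`, which trades the factor `(1/2)_k` in the denominator
of `chebRootCoeff` for a second `k!`. -/
theorem hasSum_hyp (m : ℤ) {x : ℂ} (hx : ‖x‖ < 1) :
    HasSum (fun k => halfPoch m k / (k.factorial : ℂ) ^ 2 * x ^ k) (hyp m x) := by
  have hsin : ∀ φ : ℝ, ‖x * (Real.sin φ ^ 2 : ℝ)‖ ≤ ‖x‖ := fun φ => by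
    rw [norm_mul, norm_real, Real.norm_of_nonneg (sq_nonneg _)]
    exact mul_le_of_le_one_right (norm_nonneg _) (Real.sin_sq_le_one φ)
  have hsum : Summable fun k => ‖chebRootCoeff m k * x ^ k‖ :=
    (hasSum_chebRoot m hx).summable.norm
  have key := intervalIntegral.hasSum_integral_of_dominated_convergence
    (μ := volume) (a := -π) (b := π)
    (F := fun k φ => chebRootCoeff m k * (x * (Real.sin φ ^ 2 : ℝ)) ^ k)
    (f := fun φ => chebRoot m (x * (Real.sin φ ^ 2 : ℝ)))
    (fun k _ => ‖chebRootCoeff m k * x ^ k‖)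
    (fun k => (by fun_prop : Continuous fun φ : ℝ =>
      chebRootCoeff m k * (x * (Real.sin φ ^ 2 : ℝ)) ^ k).aestronglyMeasurable)
    (fun k => Eventually.of_forall fun φ _ => by
      rw [norm_mul, norm_mul, norm_pow, norm_pow]
      exact mul_le_mul_of_nonneg_left (pow_le_pow_left₀ (norm_nonneg _) (hsin φ) k)
        (norm_nonneg _))
    (Eventually.of_forall fun _ _ => hsum) intervalIntegrable_const
    (Eventually.of_forall fun φ _ => hasSum_chebRoot m ((hsin φ).trans_lt hx))
  have hterm : ∀ k : ℕ, halfPoch m k / (k.factorial : ℂ) ^ 2 * x ^ k =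
      (2 * π : ℂ)⁻¹ * ∫ φ in (-π)..π, chebRootCoeff m k * (x * (Real.sin φ ^ 2 : ℝ)) ^ k := by
    intro k
    have : ∀ φ : ℝ, chebRootCoeff m k * (x * (Real.sin φ ^ 2 : ℝ)) ^ k =
        chebRootCoeff m k * x ^ k * ((Real.sin φ ^ (2 * k) : ℝ) : ℂ) := fun φ => by
      rw [mul_pow, pow_mul]
      push_cast
      ring
    simp only [this]
    rw [intervalIntegral.integral_const_mul, intervalIntegral.integral_ofReal,
      integral_sin_pow_even_full, chebRootCoeff]
    have h1 := poch_ne_zero k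
    have h2 := factorial_ne_zero' k
    have h3 : (π : ℂ) ≠ 0 := ofReal_ne_zero.2 Real.pi_ne_zero
    field_simp
  simp only [hterm]
  exact key.mul_left _

/-! ### The modified Bessel function of the second kind -/

/-- The integrand `exp (-eᶻ - e^{2L - z} + m z)`. -/
def macF (m : ℤ) (L z : ℂ) : ℂ := exp (-exp z - exp (2 * L - z) + m * z)

/-- The integral of `macF` over the positive half-line. -/
def macA (m : ℤ) (L : ℂ) : ℂ := ∫ τ in Set.Ioi (0 : ℝ), macF m L τ

/-- The integral of `macF` over the segment from `0` to `2L`. -/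
def macB (m : ℤ) (L : ℂ) : ℂ := 2 * L * ∫ s in (0 : ℝ)..1, macF m L (2 * L * s)

/-- The function `K_m(2 e^L)`, as an entire function of `L`. -/
def macK (m : ℤ) (L : ℂ) : ℂ :=
  1 / 2 * (exp (-(m * L)) * macA m L + exp (m * L) * macA (-m) L - exp (-(m * L)) * macB m L)

theorem exists_mul_le_exp_add (c : ℝ) : ∃ C : ℝ, ∀ τ : ℝ, 0 ≤ τ → c * τ ≤ Real.exp τ + C := by
  have hd : 0 < |c| + 1 := by positivity
  refine ⟨(|c| + 1) * Real.log (|c| + 1), fun τ hτ => ?_⟩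
  -- The tangent line of `exp` at `log (|c| + 1)` has slope at least `c`.
  have h := Real.add_one_le_exp (τ - Real.log (|c| + 1))
  rw [Real.exp_sub, Real.exp_log hd, le_div_iff₀ hd] at h
  nlinarith [le_abs_self c]

theorem exists_norm_macF_le (m : ℤ) (R : ℝ) : ∃ C : ℝ, ∀ τ : ℝ, 0 ≤ τ → ∀ L : ℂ, L.re ≤ R →
    ‖macF m L τ‖ ≤ C * Real.exp (-τ) := by
  -- The `+ 1` leaves a spare `exp (-τ)`, which makes the bound integrable.
  obtain ⟨C, hC⟩ := exists_mul_le_exp_add (m + 1)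
  refine ⟨Real.exp (C + Real.exp (2 * R)), fun τ hτ L hL => ?_⟩
  rw [macF, norm_exp, ← Real.exp_add]
  refine Real.exp_le_exp.2 ?_
  have h1 : -(exp (2 * L - τ)).re ≤ Real.exp (2 * R) := by
    refine ((neg_le_abs _).trans (abs_re_le_norm _)).trans ?_
    rw [norm_exp]
    refine Real.exp_le_exp.2 ?_
    simp
    linarith
  have h2 : (-exp (τ : ℂ) - exp (2 * L - τ) + m * τ).re =
      -Real.exp τ - (exp (2 * L - τ)).re + m * τ := by
    simp [← ofReal_exp]
  rw [h2]
  linarith [hC τ hτ]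

theorem continuous_macF (m : ℤ) : Continuous fun q : ℂ × ℂ => macF m q.1 q.2 := by
  unfold macF
  fun_prop

theorem differentiable_macF (m : ℤ) (L : ℂ) : Differentiable ℂ (macF m L) := by
  unfold macF
  fun_prop

theorem continuous_macF_ofReal (m : ℤ) (L : ℂ) : Continuous fun τ : ℝ => macF m L τ :=
  (differentiable_macF m L).continuous.comp continuous_ofReal

theorem integrableOn_macF (m : ℤ) (L : ℂ) :
    IntegrableOn (fun τ : ℝ => macF m L τ) (Set.Ioi 0) := by
  obtain ⟨C, hC⟩ := exists_norm_macF_le m L.re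
  refine ((integrableOn_exp_neg_Ioi 0).const_mul C).mono'
    (continuous_macF_ofReal m L).aestronglyMeasurable ?_
  filter_upwards [ae_restrict_mem measurableSet_Ioi] with τ hτ using hC τ (le_of_lt hτ) L le_rfl

theorem differentiable_macA (m : ℤ) : Differentiable ℂ (macA m) := by
  intro L
  obtain ⟨C, hC⟩ := exists_norm_macF_le m (L.re + 1)
  refine (hasDerivAt_integral_of_holomorphic (f := fun L (τ : ℝ) => macF m L τ) one_pos
    ((integrableOn_exp_neg_Ioi 0).const_mul C)
    (fun z _ => (continuous_macF_ofReal m z).aestronglyMeasurable) ?_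
    (Eventually.of_forall fun τ => ?_)).differentiableAt
  · filter_upwards [ae_restrict_mem measurableSet_Ioi] with τ hτ z hz
    refine hC τ (le_of_lt hτ) z ?_
    rw [mem_ball_iff_norm] at hz
    have := (re_le_norm (z - L)).trans hz.le
    rw [sub_re] at this
    linarith
  · unfold macF
    fun_prop

theorem differentiable_macB (m : ℤ) : Differentiable ℂ (macB m) := by
  intro L
  have h := (hasDerivAt_intervalIntegral_of_holomorphic (a := 0) (b := 1)
    (f := fun L (s : ℝ) => macF m L (2 * L * s)) isOpen_univ (z₀ := L) (Continuous.continuousOn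
      ((continuous_macF m).comp (by fun_prop :
        Continuous fun q : ℂ × ℝ => (q.1, 2 * q.1 * (q.2 : ℂ)))))
    (fun s _ => by unfold macF; fun_prop) (Set.mem_univ L)).differentiableAt
  exact (by fun_prop : DifferentiableAt ℂ (fun L : ℂ => 2 * L) L).mul h

/-- The integral of `macF` over the real line is not taken for complex `L`, where it may diverge at
`-∞`. The three pieces that replace it are entire in `L`. -/
theorem differentiable_macK (m : ℤ) : Differentiable ℂ (macK m) := by
  have h1 := differentiable_macA m
  have h2 := differentiable_macA (-m)
  have h3 := differentiable_macB m
  unfold macK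
  fun_prop

/-! ### Monodromy -/

theorem exp_sub_two_mul_pi_I (z : ℂ) : exp (z - 2 * (π * I)) = exp z := by
  rw [← mul_assoc, exp_sub, exp_two_pi_mul_I, div_one]

theorem exp_int_mul_pi_I_sq (m : ℤ) : exp (m * (π * I)) * exp (m * (π * I)) = 1 := by
  rw [← exp_add, show (m : ℂ) * (π * I) + m * (π * I) = m * (2 * π * I) by ring,
    exp_int_mul_two_pi_mul_I]

theorem macF_sub_pi_I (m : ℤ) (L z : ℂ) : macF m (L - π * I) z = macF m L z := by
  rw [macF, macF, show 2 * (L - π * I) - z = 2 * L - z - 2 * (π * I) by ring,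
    exp_sub_two_mul_pi_I]

theorem macA_sub_pi_I (m : ℤ) (L : ℂ) : macA m (L - π * I) = macA m L := by
  simp only [macA, macF_sub_pi_I]

theorem macF_sub_two_pi_I (m : ℤ) (L z : ℂ) : macF m L (z - 2 * (π * I)) = macF m L z := by
  have h : exp (2 * L - (z - 2 * (π * I))) = exp (2 * L - z) := by
    rw [← exp_sub_two_mul_pi_I (2 * L - (z - 2 * (π * I)))]
    congr 1
    ring
  rw [macF, macF, exp_sub_two_mul_pi_I, h, mul_sub, ← add_sub_assoc, exp_sub,
    show (m : ℂ) * (2 * (π * I)) = m * (2 * π * I) by ring, exp_int_mul_two_pi_mul_I, div_one]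

theorem mul_integral_eq_sub_of_hasDerivAt {F G : ℂ → ℂ} (hG : ∀ z, HasDerivAt G (F z) z)
    (hF : Continuous F) (z w : ℂ) :
    z * ∫ s in (0 : ℝ)..1, F (w + z * s) = G (w + z) - G w := by
  have h := intervalIntegral.integral_eq_sub_of_hasDerivAt (a := 0) (b := 1)
    (f := fun s : ℝ => G (w + z * s)) (f' := fun s : ℝ => F (w + z * s) * z) (fun s _ => ?_)
    (Continuous.intervalIntegrable (by fun_prop) _ _)
  · rw [intervalIntegral.integral_mul_const] at h
    simpa [mul_comm] using h
  · have h1 : HasDerivAt (fun s : ℂ => w + z * s) z (s : ℂ) := by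
      simpa using ((hasDerivAt_id (s : ℂ)).const_mul z).const_add w
    exact (HasDerivAt.comp (s : ℂ) (hG _) h1).comp_ofReal

theorem circleIntegral_macF (m : ℤ) (L : ℂ) :
    (∮ z in C(0, 1), exp (-1 * z + -exp (2 * L) * z⁻¹) * z ^ m * z⁻¹) =
      2 * π * I * ∫ s in (0 : ℝ)..1, macF m L (2 * π * I * s) := by
  have h := intervalIntegral.smul_integral_comp_mul_left (a := 0) (b := 1)
    (fun θ : ℝ => deriv (circleMap 0 1) θ • (exp (-1 * circleMap 0 1 θ +
      -exp (2 * L) * (circleMap 0 1 θ)⁻¹) * circleMap 0 1 θ ^ m * (circleMap 0 1 θ)⁻¹)) (2 * π)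
  rw [mul_zero, mul_one] at h
  refine h.symm.trans ?_
  rw [real_smul, mul_assoc _ I, ← intervalIntegral.integral_const_mul I]
  push_cast
  congr 2
  funext s
  have hc : circleMap 0 1 (2 * π * s) = exp (2 * π * I * s) := by
    simp only [circleMap, zero_add, ofReal_one, one_mul]
    congr 1
    push_cast
    ring
  rw [deriv_circleMap, hc, macF, exp_sub (2 * L),
    exp_add (-exp (2 * π * I * s) - _), ← exp_int_mul, smul_eq_mul,
    show -exp (2 * π * I * s) - exp (2 * L) / exp (2 * π * I * s) =
      -1 * exp (2 * π * I * s) + -exp (2 * L) * (exp (2 * π * I * s))⁻¹ by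
        rw [div_eq_mul_inv]; ring]
  have := exp_ne_zero (2 * π * I * s)
  field_simp

/-- The integrand is unchanged, but the endpoint `2L` moves by one period `2 π i`. The integral over
a period is a circle integral, by `circleIntegral_macF`. -/
theorem macB_sub_pi_I (m : ℤ) (L : ℂ) :
    macB m (L - π * I) = macB m L -
      ∮ z in C(0, 1), exp (-1 * z + -exp (2 * L) * z⁻¹) * z ^ m * z⁻¹ := by
  obtain ⟨G, hG⟩ := (differentiable_macF m L).isExactOn_univ
  have hG' : ∀ z, HasDerivAt G (macF m L z) z := fun z => hG z (Set.mem_univ z)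
  have hB : ∀ z : ℂ, z * ∫ s in (0 : ℝ)..1, macF m L (z * s) = G z - G 0 := fun z => by
    simpa using mul_integral_eq_sub_of_hasDerivAt hG' (differentiable_macF m L).continuous z 0
  -- A primitive of a periodic function is periodic up to an additive constant.
  have hconst : ∀ z w, G (z - 2 * (π * I)) - G z = G (w - 2 * (π * I)) - G w := by
    have hd : ∀ z, HasDerivAt (fun z => G (z - 2 * (π * I)) - G z) 0 z := fun z => by
      have h := ((hG' (z - 2 * (π * I))).comp_sub_const z (2 * (π * I))).sub (hG' z)
      rwa [macF_sub_two_pi_I, sub_self] at h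
    exact is_const_of_deriv_eq_zero (fun z => (hd z).differentiableAt) fun z => (hd z).deriv
  have h1 : macB m L = G (2 * L) - G 0 := hB (2 * L)
  have h2 : macB m (L - π * I) = G (2 * (L - π * I)) - G 0 := by
    rw [← hB, macB]
    simp only [macF_sub_pi_I]
  have h3 := hconst (2 * L) (2 * π * I)
  rw [show 2 * π * I - 2 * (π * I) = (0 : ℂ) by ring] at h3
  rw [circleIntegral_macF, hB, h1, h2, mul_sub]
  linear_combination h3

/-- Both `macA` terms are invariant, so only the prefactors `e^{± m L}` contribute the sign
`(-1)^m`. The circle integral split off from `macB` is the Bessel function `I_m`. -/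
theorem macK_sub_pi_I (m : ℤ) (L : ℂ) : macK m (L - π * I) =
    exp (m * (π * I)) * macK m L + π * I * besselI m (2 * exp L) := by
  have hI := circleIntegral_exp (a := -1) (b := -exp (2 * L)) (by simp) m
  have hb : (∑' k : ℕ, (-1 : ℂ) ^ k * (-exp (2 * L)) ^ ((k : ℤ) + m) /
      (Gamma (k + m + 1) * (k.factorial : ℂ))) =
      exp (m * (π * I)) * exp (m * L) * besselI m (2 * exp L) := by
    rw [besselI, ← tsum_mul_left]
    refine tsum_congr fun k => ?_
    rw [← mul_div_assoc, mul_div_cancel_left₀ _ (two_ne_zero' ℂ)]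
    congr 1
    -- With signs written as `e^{π i}`, the `k`-th terms are exponentials whose exponents differ by
    -- `2 π i k`.
    have e1 : (-1 : ℂ) = exp (π * I) := exp_pi_mul_I.symm
    have e2 : -exp (2 * L) = exp (2 * L + π * I) := by rw [exp_add, exp_pi_mul_I]; ring
    rw [e2, e1, ← exp_nat_mul, ← exp_int_mul, ← exp_int_mul, ← exp_add, ← exp_add, ← exp_add]
    have e3 : exp (k * (π * I) + ((k + m : ℤ) : ℂ) * (2 * L + π * I)) =
        exp (m * (π * I) + m * L + ((2 * k + m : ℤ) : ℂ) * L + k * (2 * π * I)) := by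
      congr 1
      push_cast
      ring
    rw [e3, exp_add _ (k * (2 * π * I) : ℂ), exp_nat_mul_two_pi_mul_I, mul_one]
  rw [hb] at hI
  have hs := exp_int_mul_pi_I_sq m
  have e1 : exp (-(m * (L - π * I))) = exp (-(m * L)) * exp (m * (π * I)) := by
    rw [← exp_add]
    congr 1
    ring
  have e2 : exp (m * (L - π * I)) = exp (m * L) * exp (m * (π * I)) := by
    rw [mul_sub, exp_sub, div_eq_iff (exp_ne_zero _), mul_assoc, hs, mul_one]
  have e3 : exp (-(m * L)) * exp (m * L) = 1 := by rw [← exp_add]; simp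
  simp only [macK]
  rw [macB_sub_pi_I, hI, macA_sub_pi_I, macA_sub_pi_I, e1, e2]
  linear_combination (π * I * besselI m (2 * exp L)) * (hs + exp (m * (π * I)) ^ 2 * (e3))

/-! ### The integral representation -/

/-- The reflection interchanges the two exponentials in the exponent; it turns the left half of the
real line into a `macA (-m)` integral. -/
theorem macF_reflect (m : ℤ) (L z : ℂ) :
    macF m L (2 * L - z) = exp (2 * m * L) * macF (-m) L z := by
  rw [macF, macF, ← exp_add, sub_sub_cancel]
  congr 1
  push_cast
  ring

theorem setIntegral_macF_Iic (m : ℤ) (L : ℝ) :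
    IntegrableOn (fun τ : ℝ => macF m L τ) (Set.Iic (2 * L)) ∧
    ∫ τ in Set.Iic (2 * L), macF m L τ = exp (2 * m * L) * macA (-m) L := by
  have hmp := Measure.measurePreserving_sub_left volume (2 * L)
  have hemb : MeasurableEmbedding fun τ : ℝ => 2 * L - τ :=
    (Homeomorph.subLeft (2 * L)).measurableEmbedding
  have hpre : (fun τ : ℝ => 2 * L - τ) ⁻¹' Set.Iic (2 * L) = Set.Ici 0 := by
    ext τ
    simp
  have hcomp : (fun τ : ℝ => macF m L ((2 * L - τ : ℝ) : ℂ)) =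
      fun τ : ℝ => exp (2 * m * L) * macF (-m) L τ := by
    funext τ
    push_cast
    exact macF_reflect m L τ
  constructor
  · rw [← hmp.integrableOn_comp_preimage hemb, hpre]
    change IntegrableOn (fun τ : ℝ => macF m L ((2 * L - τ : ℝ) : ℂ)) _
    rw [hcomp, integrableOn_Ici_iff_integrableOn_Ioi]
    exact (integrableOn_macF (-m) L).const_mul _
  · rw [← hmp.setIntegral_preimage_emb hemb, hpre, hcomp, integral_const_mul,
      integral_Ici_eq_integral_Ioi, macA]

theorem integrableOn_macF_Iic (m : ℤ) (L a : ℝ) :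
    IntegrableOn (fun τ : ℝ => macF m L τ) (Set.Iic a) := by
  have h : Set.Iic a ⊆ Set.Iic (2 * L) ∪ Set.Icc (2 * L) a := fun τ hτ => by
    rcases le_total τ (2 * L) with h | h
    · exact Or.inl h
    · exact Or.inr ⟨h, hτ⟩
  exact ((setIntegral_macF_Iic m L).1.union
    (continuous_macF_ofReal m L).continuousOn.integrableOn_Icc).mono_set h

theorem integrable_macF (m : ℤ) (L : ℝ) : Integrable fun τ : ℝ => macF m L τ := by
  rw [← integrableOn_univ, ← Set.Iic_union_Ioi (a := 0)]
  exact (integrableOn_macF_Iic m L 0).union (integrableOn_macF m L)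

/-- Explains the form of `macK`: the line is `(-∞, 2L]` plus `[0, ∞)` minus the oriented segment
from `0` to `2L`. -/
theorem integral_macF (m : ℤ) (L : ℝ) :
    ∫ τ : ℝ, macF m L τ = 2 * exp (m * L) * macK m L := by
  have h1 := intervalIntegral.integral_Iic_add_Ioi (integrableOn_macF_Iic m L 0)
    (integrableOn_macF m L)
  have h2 := intervalIntegral.integral_Iic_sub_Iic (integrableOn_macF_Iic m L 0)
    (integrableOn_macF_Iic m L (2 * L))
  have h3 : macB m L = ∫ τ in (0 : ℝ)..(2 * L), macF m L τ := by
    have h := intervalIntegral.smul_integral_comp_mul_left (a := 0) (b := 1)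
      (fun τ : ℝ => macF m L τ) (2 * L)
    rw [mul_zero, mul_one] at h
    rw [← h, real_smul, macB]
    push_cast
    rfl
  rw [(setIntegral_macF_Iic m L).2, ← h3] at h2
  rw [← h1, macK]
  change _ + macA m L = _
  have e1 : exp (m * L) * exp (-(m * L)) = 1 := by rw [← exp_add]; simp
  have e2 : exp (2 * m * L) = exp (m * L) * exp (m * L) := by rw [← exp_add]; ring_nf
  rw [e2] at h2
  linear_combination -h2 + (macB m L - macA m L) * e1

/-! ### The Laplace transform of the Borel transform -/

theorem exists_norm_eval_le (P : Polynomial ℂ) {δ : ℝ} (hδ : 0 < δ) :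
    ∃ C : ℝ, 0 ≤ C ∧ ∀ s : ℝ, 0 ≤ s → ‖P.eval (1 + 2 * (s : ℂ))‖ ≤ C * Real.exp (δ * s) := by
  induction P using Polynomial.induction_on' with
  | add P Q hP hQ =>
    obtain ⟨C, hC, h1⟩ := hP
    obtain ⟨D, hD, h2⟩ := hQ
    refine ⟨C + D, by positivity, fun s hs => ?_⟩
    rw [Polynomial.eval_add, add_mul]
    exact (norm_add_le _ _).trans (add_le_add (h1 s hs) (h2 s hs))
  | monomial n a =>
    refine ⟨‖a‖ * ((2 / δ) ^ n * n.factorial * Real.exp (δ / 2)), by positivity, fun s hs => ?_⟩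
    have h0 : (0 : ℝ) < n.factorial := by exact_mod_cast n.factorial_pos
    -- The scale `δ / 2` is chosen so that the exponential grows exactly like `e^{δ s}`.
    have h := Real.pow_div_factorial_le_exp (δ / 2 * (1 + 2 * s)) (by positivity) n
    rw [div_le_iff₀ h0, mul_pow] at h
    have h1 : ‖(1 + 2 * (s : ℂ))‖ = 1 + 2 * s := by
      rw [show (1 + 2 * (s : ℂ)) = ((1 + 2 * s : ℝ) : ℂ) by push_cast; ring, norm_real,
        Real.norm_of_nonneg (by positivity)]
    rw [Polynomial.eval_monomial, norm_mul, norm_pow, h1, mul_assoc ‖a‖]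
    refine mul_le_mul_of_nonneg_left ?_ (norm_nonneg _)
    have h2 : Real.exp (δ / 2 * (1 + 2 * s)) = Real.exp (δ / 2) * Real.exp (δ * s) := by
      rw [← Real.exp_add]
      ring_nf
    have h3 : (2 / δ) ^ n * (δ / 2) ^ n = 1 := by
      rw [← mul_pow, show 2 / δ * (δ / 2) = 1 by field_simp, one_pow]
    calc (1 + 2 * s) ^ n = (2 / δ) ^ n * ((δ / 2) ^ n * (1 + 2 * s) ^ n) := by
          rw [← mul_assoc, h3, one_mul]
      _ ≤ (2 / δ) ^ n * (Real.exp (δ / 2 * (1 + 2 * s)) * n.factorial) := by gcongr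
      _ = _ := by rw [h2]; ring

theorem norm_cpow_neg_half_le_one {s : ℝ} (hs : 0 ≤ s) :
    ‖(1 - -(s : ℂ)) ^ (-(1 / 2) : ℂ)‖ ≤ 1 := by
  rw [show (1 - -(s : ℂ)) = ((1 + s : ℝ) : ℂ) by push_cast; ring,
    norm_cpow_eq_rpow_re_of_pos (by positivity)]
  exact Real.rpow_le_one_of_one_le_of_nonpos (by linarith) (by norm_num)

theorem exists_norm_chebRoot_le (m : ℤ) {δ : ℝ} (hδ : 0 < δ) :
    ∃ C : ℝ, 0 ≤ C ∧ ∀ s : ℝ, 0 ≤ s → ‖chebRoot m (-(s : ℂ))‖ ≤ C * Real.exp (δ * s) := by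
  obtain ⟨C, hC, h⟩ := exists_norm_eval_le (Polynomial.Chebyshev.T ℂ m) hδ
  refine ⟨C, hC, fun s hs => ?_⟩
  rw [chebRoot, norm_mul, mul_neg, sub_neg_eq_add]
  exact (mul_le_of_le_one_right (norm_nonneg _) (norm_cpow_neg_half_le_one hs)).trans (h s hs)

/-- Since `δ` is arbitrary, the Laplace integral converges for all `w` with positive real part, as
the full sector of opening `π` requires. -/
theorem exists_norm_hyp_le (m : ℤ) {δ : ℝ} (hδ : 0 < δ) :
    ∃ C : ℝ, 0 ≤ C ∧ ∀ s : ℝ, 0 ≤ s → ‖hyp m (-(s : ℂ))‖ ≤ C * Real.exp (δ * s) := by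
  obtain ⟨C, hC, h⟩ := exists_norm_chebRoot_le m hδ
  refine ⟨C, hC, fun s hs => ?_⟩
  have hb : ‖∫ φ in (-π)..π, chebRoot m (-(s : ℂ) * (Real.sin φ ^ 2 : ℝ))‖ ≤
      C * Real.exp (δ * s) * |π - -π| := by
    refine intervalIntegral.norm_integral_le_of_norm_le_const fun φ _ => ?_
    have h1 := h (s * Real.sin φ ^ 2) (by positivity)
    rw [ofReal_mul, ← neg_mul] at h1
    refine h1.trans ?_
    gcongr
    exact mul_le_of_le_one_right hs (Real.sin_sq_le_one φ)
  rw [sub_neg_eq_add, ← two_mul, abs_of_pos Real.two_pi_pos] at hb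
  have h2 : ‖(2 * π : ℂ)⁻¹‖ = (2 * π)⁻¹ := by
    rw [norm_inv, show (2 * π : ℂ) = ((2 * π : ℝ) : ℂ) by push_cast; rfl, norm_real,
      Real.norm_of_nonneg Real.two_pi_pos.le]
  rw [hyp, norm_mul, h2, inv_mul_le_iff₀ Real.two_pi_pos]
  linarith

theorem continuousOn_hyp_neg (m : ℤ) :
    ContinuousOn (fun s : ℝ => hyp m (-(s : ℂ))) (Set.Ioi 0) := by
  refine (differentiableOn_hyp m).continuousOn.comp (by fun_prop) fun s hs => ?_
  have : (0 : ℝ) < s := hs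
  simp
  linarith

theorem aestronglyMeasurable_laplace (m : ℤ) (w : ℂ) : AEStronglyMeasurable
    (fun s : ℝ => hyp m (-(s : ℂ)) * exp (-(w * s))) (volume.restrict (Set.Ioi 0)) :=
  ((continuousOn_hyp_neg m).mul (by fun_prop)).aestronglyMeasurable measurableSet_Ioi

theorem exists_laplace_bound (m : ℤ) {ε : ℝ} (hε : 0 < ε) :
    ∃ C : ℝ, ∀ s : ℝ, 0 ≤ s → ∀ w : ℂ, ε ≤ w.re →
      ‖hyp m (-(s : ℂ)) * exp (-(w * s))‖ ≤ C * Real.exp (-(ε / 2) * s) := by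
  obtain ⟨C, hC, h⟩ := exists_norm_hyp_le m (half_pos hε)
  refine ⟨C, fun s hs w hw => ?_⟩
  have h1 : ‖exp (-(w * s))‖ ≤ Real.exp (-(ε * s)) := by
    rw [norm_exp]
    refine Real.exp_le_exp.2 ?_
    simp only [neg_re, re_mul_ofReal]
    nlinarith
  rw [norm_mul]
  calc _ ≤ C * Real.exp (ε / 2 * s) * Real.exp (-(ε * s)) :=
        mul_le_mul (h s hs) h1 (norm_nonneg _) (by positivity)
    _ = _ := by
        rw [mul_assoc, ← Real.exp_add]
        ring_nf

theorem integrableOn_laplace (m : ℤ) {w : ℂ} (hw : 0 < w.re) :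
    IntegrableOn (fun s : ℝ => hyp m (-(s : ℂ)) * exp (-(w * s))) (Set.Ioi 0) := by
  obtain ⟨C, hC⟩ := exists_laplace_bound m hw
  refine ((integrableOn_exp_mul_Ioi (by linarith : -(w.re / 2) < 0) 0).const_mul C).mono'
    (aestronglyMeasurable_laplace m w) ?_
  filter_upwards [ae_restrict_mem measurableSet_Ioi] with s hs using hC s (le_of_lt hs) w le_rfl

/-- The Laplace transform of `s ↦ ₂F₁(1/2 + m, 1/2 - m; 1; -s)`. -/
def laplaceHyp (m : ℤ) (w : ℂ) : ℂ := ∫ s in Set.Ioi (0 : ℝ), hyp m (-(s : ℂ)) * exp (-(w * s))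

theorem differentiableAt_laplaceHyp (m : ℤ) {w : ℂ} (hw : 0 < w.re) :
    DifferentiableAt ℂ (laplaceHyp m) w := by
  obtain ⟨C, hC⟩ := exists_laplace_bound m (half_pos hw)
  refine (hasDerivAt_integral_of_holomorphic (half_pos hw)
    ((integrableOn_exp_mul_Ioi (by linarith : -(w.re / 2 / 2) < 0) 0).const_mul C)
    (fun z _ => aestronglyMeasurable_laplace m z) ?_
    (Eventually.of_forall fun s => by fun_prop)).differentiableAt
  filter_upwards [ae_restrict_mem measurableSet_Ioi] with s hs z hz
  refine hC s (le_of_lt hs) z ?_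
  rw [mem_ball_iff_norm] at hz
  have := ((abs_re_le_norm (z - w)).trans hz.le)
  rw [sub_re, abs_le] at this
  linarith [this.1]

/-! ### Evaluation on the real axis -/

theorem integrableOn_polar (m : ℤ) {w : ℝ} (hw : 0 < w) :
    IntegrableOn (fun q : ℝ × ℝ => (q.1 : ℂ) * (exp (-(w * (q.1 : ℂ) ^ 2)) *
      chebRoot m (-((q.1 : ℂ) ^ 2) * (Real.sin q.2 ^ 2 : ℝ))))
      (Set.Ioi 0 ×ˢ Set.Ioo (-π) π) (volume.prod volume) := by
  obtain ⟨C, hC, h⟩ := exists_norm_chebRoot_le m (half_pos hw)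
  have hb : Integrable (fun q : ℝ × ℝ => (q.1 * Real.exp (-(w / 2) * q.1 ^ 2)) * C)
      ((volume.restrict (Set.Ioi 0)).prod (volume.restrict (Set.Ioo (-π) π))) :=
    ((integrable_mul_exp_neg_mul_sq (half_pos hw)).restrict).mul_prod (g := fun _ => C)
      (integrable_const C)
  rw [IntegrableOn, ← Measure.prod_restrict]
  refine hb.mono' ?_ ?_
  · rw [Measure.prod_restrict]
    refine ContinuousOn.aestronglyMeasurable ?_ (measurableSet_Ioi.prod measurableSet_Ioo)
    have h1 : ContinuousOn (fun q : ℝ × ℝ =>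
        chebRoot m (-((q.1 : ℂ) ^ 2) * (Real.sin q.2 ^ 2 : ℝ))) (Set.Ioi 0 ×ˢ Set.Ioo (-π) π) := by
      refine (differentiableOn_chebRoot m).continuousOn.comp (by fun_prop) fun q _ => ?_
      refine re_mul_sin_sq_lt (lt_of_le_of_lt (b := 0) ?_ one_pos) q.2
      rw [← ofReal_pow, ← ofReal_neg, ofReal_re]
      linarith [sq_nonneg q.1]
    fun_prop
  · rw [Measure.prod_restrict]
    filter_upwards [ae_restrict_mem (measurableSet_Ioi.prod measurableSet_Ioo)] with q hq
    have hq0 : 0 < q.1 := hq.1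
    have h1 := h (q.1 ^ 2 * Real.sin q.2 ^ 2) (by positivity)
    rw [ofReal_mul, ← neg_mul, ofReal_pow] at h1
    have h2 : Real.exp (w / 2 * (q.1 ^ 2 * Real.sin q.2 ^ 2)) ≤ Real.exp (w / 2 * q.1 ^ 2) := by
      refine Real.exp_le_exp.2 (mul_le_mul_of_nonneg_left ?_ (half_pos hw).le)
      exact mul_le_of_le_one_right (sq_nonneg _) (Real.sin_sq_le_one _)
    have h3 : ‖exp (-(w * (q.1 : ℂ) ^ 2))‖ = Real.exp (-(w * q.1 ^ 2)) := by
      rw [norm_exp]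
      congr 1
      rw [← ofReal_pow, ← ofReal_mul, ← ofReal_neg, ofReal_re]
    have h4 : Real.exp (-(w / 2) * q.1 ^ 2) =
        Real.exp (-(w * q.1 ^ 2)) * Real.exp (w / 2 * q.1 ^ 2) := by
      rw [← Real.exp_add]
      ring_nf
    rw [norm_mul, norm_mul, h3, norm_real, Real.norm_of_nonneg hq0.le, h4]
    have h5 := h1.trans (mul_le_mul_of_nonneg_left h2 hC)
    calc _ ≤ q.1 * (Real.exp (-(w * q.1 ^ 2)) * (C * Real.exp (w / 2 * q.1 ^ 2))) := by gcongr
      _ = _ := by ring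

/-- With `s = ρ²` the Laplace integral and the angular mean in `hyp` combine into a plane integral
in polar coordinates. Its integrand is a Gaussian in one Cartesian coordinate times a function of
the other, `ρ sin φ`. -/
theorem laplaceHyp_eq_gaussian (m : ℤ) {w : ℝ} (hw : 0 < w) :
    laplaceHyp m w = (π : ℂ)⁻¹ * ((√(π / w) : ℝ) *
      ∫ a : ℝ, exp (-(w * (a : ℂ) ^ 2)) * chebRoot m (-((a : ℂ) ^ 2))) := by
  have h1 : laplaceHyp m w = ∫ ρ in Set.Ioi (0 : ℝ), (π : ℂ)⁻¹ * ∫ φ in Set.Ioo (-π) π,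
      (ρ : ℂ) * (exp (-(w * (ρ : ℂ) ^ 2)) *
        chebRoot m (-((ρ : ℂ) ^ 2) * (Real.sin φ ^ 2 : ℝ))) := by
    rw [laplaceHyp, ← integral_comp_rpow_Ioi_of_pos (two_pos (α := ℝ))]
    refine setIntegral_congr_fun measurableSet_Ioi fun ρ hρ => ?_
    simp only [Real.rpow_two, show (2 : ℝ) - 1 = 1 by norm_num, Real.rpow_one]
    rw [hyp, intervalIntegral.integral_of_le (by linarith [Real.pi_pos]),
      ← integral_Ioc_eq_integral_Ioo, integral_const_mul, integral_const_mul, real_smul]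
    have hpi : (π : ℂ) ≠ 0 := ofReal_ne_zero.2 Real.pi_ne_zero
    push_cast
    field_simp
  have h2 := integral_comp_polarCoord_symm (fun q : ℝ × ℝ =>
    exp (-(w * (q.1 : ℂ) ^ 2)) * (exp (-(w * (q.2 : ℂ) ^ 2)) * chebRoot m (-((q.2 : ℂ) ^ 2))))
  have h3 : (∫ q : ℝ × ℝ, exp (-(w * (q.1 : ℂ) ^ 2)) *
      (exp (-(w * (q.2 : ℂ) ^ 2)) * chebRoot m (-((q.2 : ℂ) ^ 2)))) =
      (√(π / w) : ℝ) * ∫ a : ℝ, exp (-(w * (a : ℂ) ^ 2)) * chebRoot m (-((a : ℂ) ^ 2)) := by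
    rw [Measure.volume_eq_prod, integral_prod_mul (fun a : ℝ => exp (-(w * (a : ℂ) ^ 2)))
      (fun a : ℝ => exp (-(w * (a : ℂ) ^ 2)) * chebRoot m (-((a : ℂ) ^ 2))),
      ← integral_gaussian, ← integral_complex_ofReal]
    congr 2
    funext a
    push_cast
    ring_nf
  have h4 : ∀ q : ℝ × ℝ, q.1 • (exp (-(w * ((polarCoord.symm q).1 : ℂ) ^ 2)) *
      (exp (-(w * ((polarCoord.symm q).2 : ℂ) ^ 2)) *
        chebRoot m (-(((polarCoord.symm q).2 : ℂ) ^ 2)))) =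
      (q.1 : ℂ) * (exp (-(w * (q.1 : ℂ) ^ 2)) *
        chebRoot m (-((q.1 : ℂ) ^ 2) * (Real.sin q.2 ^ 2 : ℝ))) := by
    intro q
    rw [polarCoord_symm_apply, real_smul, ← mul_assoc (exp _), ← exp_add]
    have e1 : -(w * ((q.1 * Real.cos q.2 : ℝ) : ℂ) ^ 2) + -(w * ((q.1 * Real.sin q.2 : ℝ) : ℂ) ^ 2)
        = -(w * (q.1 : ℂ) ^ 2) := by
      have := Real.sin_sq_add_cos_sq q.2
      have : ((Real.sin q.2 : ℝ) : ℂ) ^ 2 + ((Real.cos q.2 : ℝ) : ℂ) ^ 2 = 1 := by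
        exact_mod_cast this
      rw [ofReal_mul, ofReal_mul]
      linear_combination -(w * (q.1 : ℂ) ^ 2) * this
    rw [e1]
    congr 3
    push_cast
    ring
  simp only [h4] at h2
  rw [h1, integral_const_mul, ← h3, ← h2, polarCoord_target, Measure.volume_eq_prod,
    setIntegral_prod _ (integrableOn_polar m hw)]

theorem integral_macF_eq_cosh (m : ℤ) (Λ : ℝ) :
    Integrable (fun t : ℝ => exp (-(2 * exp Λ * cosh t)) * exp (m * t)) ∧
    ∫ t : ℝ, exp (-(2 * exp Λ * cosh t)) * exp (m * t) = 2 * macK m Λ := by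
  have h : ∀ t : ℝ, exp (-(2 * exp Λ * cosh t)) * exp (m * t) =
      exp (-(m * Λ)) * macF m Λ ((t + Λ : ℝ) : ℂ) := by
    intro t
    rw [macF, ← exp_add, ← exp_add, cosh]
    congr 1
    push_cast
    rw [exp_add, show 2 * (Λ : ℂ) - (t + Λ) = Λ + -t by ring, exp_add (Λ : ℂ)]
    ring
  simp only [h]
  refine ⟨((integrable_macF m Λ).comp_add_right Λ).const_mul _, ?_⟩
  rw [integral_const_mul, integral_add_right_eq_self (fun t : ℝ => macF m Λ t), integral_macF,
    ← mul_assoc, mul_left_comm, ← exp_add]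
  simp

theorem integral_cosh_mul (m : ℤ) (Λ : ℝ) :
    ∫ t : ℝ, exp (-(2 * exp Λ * cosh t)) * cosh (m * t) = 2 * macK m Λ := by
  obtain ⟨hi, he⟩ := integral_macF_eq_cosh m Λ
  have hn : ∀ t : ℝ, exp (-(2 * exp Λ * cosh t)) * exp (-(m * t)) =
      (fun t : ℝ => exp (-(2 * exp Λ * cosh t)) * exp (m * t)) (-t) := fun t => by
    simp
  have h : ∀ t : ℝ, exp (-(2 * exp Λ * cosh t)) * cosh (m * t) =
      1 / 2 * (exp (-(2 * exp Λ * cosh t)) * exp (m * t) +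
        exp (-(2 * exp Λ * cosh t)) * exp (-(m * t))) := fun t => by
    rw [cosh.eq_1 (m * t)]
    ring
  simp only [h]
  simp only [hn]
  rw [integral_const_mul, integral_add hi hi.comp_neg,
    integral_neg_eq_self (fun t : ℝ => exp (-(2 * exp Λ * cosh t)) * exp (m * t)), he]
  ring

/-- Here `1 + 2 sinh² τ = cosh 2τ`, `T_m(cosh x) = cosh (m x)` and `√(1 + sinh² τ) = cosh τ`. -/
theorem chebRoot_neg_sinh_sq (m : ℤ) (τ : ℝ) :
    chebRoot m (-((Real.sinh τ : ℂ) ^ 2)) = cosh (m * ((2 * τ : ℝ) : ℂ)) / Real.cosh τ := by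
  have h1 : 1 - 2 * -((Real.sinh τ : ℂ) ^ 2) = cosh ((2 * τ : ℝ) : ℂ) := by
    have := cosh_sq (τ : ℂ)
    push_cast
    rw [cosh_two_mul]
    linear_combination -this
  have h2 : 1 - -((Real.sinh τ : ℂ) ^ 2) = ((Real.cosh τ ^ 2 : ℝ) : ℂ) := by
    rw [Real.cosh_sq]
    push_cast
    ring
  rw [chebRoot, h1, h2, Polynomial.Chebyshev.T_complex_cosh,
    show (-(1 / 2) : ℂ) = ((-(1 / 2) : ℝ) : ℂ) by push_cast; rfl, ← ofReal_cpow (sq_nonneg _),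
    ← Real.rpow_natCast, ← Real.rpow_mul (Real.cosh_pos τ).le,
    show ((2 : ℕ) : ℝ) * -(1 / 2) = -1 by norm_num, Real.rpow_neg_one, div_eq_mul_inv]
  push_cast
  rfl

/-- Substituting `a = sinh τ`, the Jacobian cancels the denominator of `chebRoot`, and `4 sinh² τ =
2 cosh 2τ - 2` splits off `exp (2 e^Λ)`. -/
theorem integral_chebRoot (m : ℤ) (Λ : ℝ) :
    ∫ a : ℝ, exp (-(4 * exp Λ * (a : ℂ) ^ 2)) * chebRoot m (-((a : ℂ) ^ 2)) =
      exp (2 * exp Λ) * macK m Λ := by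
  have h := integral_image_eq_integral_abs_deriv_smul (s := Set.univ) MeasurableSet.univ
    (fun τ _ => (Real.hasDerivAt_sinh τ).hasDerivWithinAt) Real.sinh_injective.injOn
    (fun a : ℝ => exp (-(4 * exp Λ * (a : ℂ) ^ 2)) * chebRoot m (-((a : ℂ) ^ 2)))
  rw [Set.image_univ, Real.sinh_surjective.range_eq, setIntegral_univ, setIntegral_univ] at h
  rw [h]
  have h2 : ∀ τ : ℝ, |Real.cosh τ| • (exp (-(4 * exp Λ * (Real.sinh τ : ℂ) ^ 2)) *
      chebRoot m (-((Real.sinh τ : ℂ) ^ 2))) = exp (2 * exp Λ) *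
      (fun t : ℝ => exp (-(2 * exp Λ * cosh t)) * cosh (m * t)) (2 * τ) := by
    intro τ
    have hc : (Real.cosh τ : ℂ) ≠ 0 := ofReal_ne_zero.2 (Real.cosh_pos τ).ne'
    have e : exp (2 * exp Λ) * exp (-(2 * exp Λ * cosh ((2 * τ : ℝ) : ℂ))) =
        exp (-(4 * exp Λ * (Real.sinh τ : ℂ) ^ 2)) := by
      rw [← exp_add]
      congr 1
      have := cosh_sq (τ : ℂ)
      push_cast
      rw [cosh_two_mul]
      linear_combination -2 * exp Λ * this
    rw [chebRoot_neg_sinh_sq, abs_of_pos (Real.cosh_pos τ), real_smul, ← e]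
    field_simp
  simp only [h2]
  rw [integral_const_mul, Measure.integral_comp_mul_left (fun t : ℝ =>
    exp (-(2 * exp Λ * cosh t)) * cosh (m * t)), integral_cosh_mul, abs_of_pos (by norm_num),
    real_smul]
  push_cast
  ring

theorem laplaceHyp_real (m : ℤ) (Λ : ℝ) : 4 * exp Λ * laplaceHyp m (4 * exp Λ) =
    2 * ((√π : ℝ) : ℂ)⁻¹ * exp (Λ / 2) * exp (2 * exp Λ) * macK m Λ := by
  have hw : (0 : ℝ) < 4 * Real.exp Λ := by positivity
  have h := laplaceHyp_eq_gaussian m hw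
  have hs : √(π / (4 * Real.exp Λ)) = √π / (2 * Real.exp (Λ / 2)) := by
    rw [Real.sqrt_div Real.pi_pos.le, show 4 * Real.exp Λ = (2 * Real.exp (Λ / 2)) ^ 2 by
      rw [mul_pow, ← Real.exp_nat_mul]; norm_num; ring_nf, Real.sqrt_sq (by positivity)]
  have hp : (((√π : ℝ) : ℂ)) ^ 2 = π := by
    rw [← ofReal_pow, Real.sq_sqrt Real.pi_pos.le]
  have hp0 : ((√π : ℝ) : ℂ) ≠ 0 := ofReal_ne_zero.2 (Real.sqrt_pos.2 Real.pi_pos).ne'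
  have he : exp (Λ : ℂ) = exp (Λ / 2) * exp (Λ / 2) := by rw [← exp_add]; ring_nf
  rw [hs] at h
  push_cast at h
  rw [h, integral_chebRoot, ← hp]
  nth_rewrite 1 [he]
  have he0 := exp_ne_zero (Λ / 2 : ℂ)
  field_simp
  ring

/-- Both sides are analytic on the strip, where `e^Λ` has positive real part, and agree at the real
points `1/(n + 1)`, which accumulate at `0`. -/
theorem laplaceHyp_eq (m : ℤ) {Λ : ℂ} (hΛ : |Λ.im| < π / 2) :
    4 * exp Λ * laplaceHyp m (4 * exp Λ) =
      2 * ((√π : ℝ) : ℂ)⁻¹ * exp (Λ / 2) * exp (2 * exp Λ) * macK m Λ := by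
  have hset : {z : ℂ | |z.im| < π / 2} = imLm ⁻¹' Set.Ioo (-(π / 2)) (π / 2) := by
    ext z
    simp [abs_lt]
  have hopen : IsOpen {z : ℂ | |z.im| < π / 2} :=
    isOpen_lt (continuous_abs.comp continuous_im) continuous_const
  have hconv : Convex ℝ {z : ℂ | |z.im| < π / 2} := by
    rw [hset]
    exact (convex_Ioo _ _).linear_preimage imLm
  have hre : ∀ z : ℂ, |z.im| < π / 2 → 0 < (4 * exp z).re := by
    intro z hz
    rw [abs_lt] at hz
    have := Real.cos_pos_of_mem_Ioo ⟨hz.1, hz.2⟩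
    simp [exp_re]
    positivity
  have h1 : AnalyticOnNhd ℂ (fun z => 4 * exp z * laplaceHyp m (4 * exp z))
      {z : ℂ | |z.im| < π / 2} := by
    refine DifferentiableOn.analyticOnNhd (fun z hz => ?_) hopen
    have h := (differentiableAt_laplaceHyp m (hre z hz)).comp z
      (by fun_prop : DifferentiableAt ℂ (fun z => 4 * exp z) z)
    exact ((by fun_prop : DifferentiableAt ℂ (fun z => 4 * exp z) z).mul h).differentiableWithinAt
  have h2 : AnalyticOnNhd ℂ (fun z => 2 * ((√π : ℝ) : ℂ)⁻¹ * exp (z / 2) * exp (2 * exp z) *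
      macK m z) {z : ℂ | |z.im| < π / 2} := by
    have hK := differentiable_macK m
    exact DifferentiableOn.analyticOnNhd (by fun_prop) hopen
  refine h1.eqOn_of_preconnected_of_frequently_eq h2 hconv.isPreconnected (z₀ := 0)
    (by simp [Real.pi_pos]) ?_ hΛ
  have hlim : Tendsto (fun n : ℕ => ((1 / ((n : ℝ) + 1) : ℝ) : ℂ)) atTop (𝓝[≠] 0) := by
    refine tendsto_nhdsWithin_iff.2 ⟨?_, Eventually.of_forall fun n => ?_⟩
    · exact (continuous_ofReal.tendsto' 0 0 ofReal_zero).comp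
        tendsto_one_div_add_atTop_nhds_zero_nat
    · have : (0 : ℝ) < 1 / ((n : ℝ) + 1) := by positivity
      exact ofReal_ne_zero.2 this.ne'
  exact hlim.frequently (Frequently.of_forall fun n => laplaceHyp_real m _)

/-! ### Borel summability -/

/-- Two Borel transforms agree near `0`, hence on the connected ray; the Laplace integrals then
agree on the sector, and the entire functions everywhere. As `borelSum` is picked by choice, this is
what identifies it with an explicit formula. -/
theorem IsBorelSum.unique {a : ℕ → ℂ} {θ : ℝ} {S S' : ℂ → ℂ} (h : IsBorelSum a θ S)
    (h' : IsBorelSum a θ S') : S = S' := by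
  obtain ⟨hS, F, ⟨hF0, hF⟩, hFS⟩ := h
  obtain ⟨hS', F', ⟨hF0', hF'⟩, hFS'⟩ := h'
  have hray : {χ : ℂ | ∃ t : ℝ, 0 ≤ t ∧ χ = t * exp (θ * I)} =
      (fun t : ℝ => (t : ℂ) * exp (θ * I)) '' Set.Ici 0 := by
    ext χ
    constructor
    · rintro ⟨t, ht, rfl⟩
      exact ⟨t, ht, rfl⟩
    · rintro ⟨t, ht, rfl⟩
      exact ⟨t, ht, rfl⟩
  have hconn : IsPreconnected {χ : ℂ | ∃ t : ℝ, 0 ≤ t ∧ χ = t * exp (θ * I)} := by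
    rw [hray]
    exact isPreconnected_Ici.image _ (by fun_prop)
  have hev : F =ᶠ[𝓝 0] F' := by
    filter_upwards [hF0, hF0'] with χ h1 h2 using h1.unique h2
  have hFF' := hF.eqOn_of_preconnected_of_eventuallyEq hF' hconn ⟨0, le_rfl, by simp⟩ hev
  refine AnalyticOnNhd.eq_of_eventuallyEq (z₀ := -(θ * I)) (𝕜 := ℂ)
    (fun z _ => hS.analyticAt z) (fun z _ => hS'.analyticAt z) ?_
  have hopen : IsOpen {ℓ : ℂ | |ℓ.im + θ| < π / 2} := by
    refine isOpen_lt ?_ continuous_const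
    exact continuous_abs.comp (continuous_im.add continuous_const)
  have hmem : -(θ * I) ∈ {ℓ : ℂ | |ℓ.im + θ| < π / 2} := by
    simp [Real.pi_pos]
  filter_upwards [hopen.mem_nhds hmem] with ℓ hℓ
  rw [(hFS ℓ hℓ).2, (hFS' ℓ hℓ).2]
  congr 1
  refine setIntegral_congr_fun measurableSet_Ioi fun t ht => ?_
  rw [hFF' ⟨t, le_of_lt ht, rfl⟩]

theorem IsBorelSum.borelSum_eq {a : ℕ → ℂ} {θ : ℝ} {S : ℂ → ℂ} (h : IsBorelSum a θ S) :
    borelSum a θ = S := by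
  have hex : ∃ S, IsBorelSum a θ S := ⟨S, h⟩
  rw [borelSum, dif_pos hex]
  exact hex.choose_spec.unique h

/-- The Borel resummation of `φ_p^m`, as a function of `Λ = log (-ζ eᵘ / p)`. -/
def resummed (m : ℤ) (Λ : ℂ) : ℂ := 2 / π * exp (Λ / 2) * exp (2 * exp Λ) * macK m Λ

theorem differentiable_resummed (m : ℤ) : Differentiable ℂ (resummed m) := by
  have := differentiable_macK m
  unfold resummed
  fun_prop

/-- The ray of resummation corresponds to the negative real axis in the variable of `hyp`, away from
the singularity at `1`. -/
theorem exp_direction_mul (u : ℂ) (α : ℝ) : exp (direction u α * I) * (exp (α * I) / (4 * exp u)) =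
    -((Real.exp (-u.re) / 4 : ℝ) : ℂ) := by
  have h : exp (direction u α * I) * exp (α * I) = -exp (-(u.re : ℂ)) * exp u := by
    rw [neg_mul, ← exp_add, ← exp_add, ← mul_neg_one (exp (-(u.re : ℂ) + u)), ← exp_neg_pi_mul_I,
      ← exp_add]
    congr 1
    rw [direction]
    push_cast
    linear_combination re_add_im u
  rw [← mul_div_assoc, h]
  have := exp_ne_zero u
  push_cast
  field_simp

theorem isBorelTransformAlong_hyp (u : ℂ) (α : ℝ) (m : ℤ) :
    IsBorelTransformAlong (phiCoeff u (exp (α * I)) m) (direction u α)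
      (fun χ => ((√π : ℝ) : ℂ)⁻¹ * hyp m (χ * (exp (α * I) / (4 * exp u)))) := by
  set q := exp (α * I) / (4 * exp u) with hq
  constructor
  · have hcont : Tendsto (fun χ : ℂ => ‖χ * q‖) (𝓝 0) (𝓝 0) := by
      have : Continuous fun χ : ℂ => ‖χ * q‖ := by fun_prop
      simpa using this.tendsto 0
    filter_upwards [hcont.eventually_lt_const one_pos] with χ hχ
    have h := (hasSum_hyp m hχ).mul_left ((√π : ℝ) : ℂ)⁻¹
    refine h.congr_fun ?_
    intro k
    rw [phiCoeff_eq, ← hq, mul_pow]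
    have := factorial_ne_zero' k
    field_simp
  · have hU : IsOpen {χ : ℂ | (χ * q).re < 1} :=
      isOpen_lt (continuous_re.comp (by fun_prop)) continuous_const
    have hd : DifferentiableOn ℂ (fun χ => ((√π : ℝ) : ℂ)⁻¹ * hyp m (χ * q))
        {χ : ℂ | (χ * q).re < 1} :=
      ((differentiableOn_hyp m).comp (f := fun χ => χ * q) (by fun_prop)
        fun χ hχ => hχ).const_mul _
    refine (hd.analyticOnNhd hU).mono ?_
    rintro χ ⟨t, ht, rfl⟩
    have : 0 ≤ t * (Real.exp (-u.re) / 4) := by positivity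
    rw [Set.mem_ofPred_eq, mul_assoc, exp_direction_mul, mul_neg, ← ofReal_mul, ← ofReal_neg,
      ofReal_re]
    linarith

theorem isBorelSum_resummed (u : ℂ) (α : ℝ) (m : ℤ) :
    IsBorelSum (phiCoeff u (exp (α * I)) m) (direction u α)
      (fun ℓ => resummed m (ℓ + u - α * I - π * I)) := by
  refine ⟨(differentiable_resummed m).comp (by fun_prop), _, isBorelTransformAlong_hyp u α m,
    fun ℓ hℓ => ?_⟩
  set Λ := ℓ + u - α * I - π * I with hΛdef
  set c : ℝ := Real.exp (-u.re) / 4 with hc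
  have hc0 : 0 < c := by positivity
  have hΛ : |Λ.im| < π / 2 := by
    convert hℓ using 2
    -- `Im Λ = Im ℓ + θ`, so the sector of convergence is exactly the strip of `laplaceHyp_eq`.
    simp [hΛdef, direction]
    ring
  -- After rescaling the ray by `s = c t`, the Laplace variable becomes `4 e^Λ`.
  have hw : exp ℓ * exp (direction u α * I) = 4 * exp Λ * c := by
    rw [hc, ← exp_add]
    have : 4 * exp Λ * ((Real.exp (-u.re) / 4 : ℝ) : ℂ) = exp (Λ + -(u.re : ℂ)) := by
      rw [exp_add]
      push_cast
      ring
    rw [this]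
    congr 1
    rw [hΛdef, direction]
    push_cast
    linear_combination re_add_im u
  have hre : 0 < (4 * exp Λ).re := by
    rw [abs_lt] at hΛ
    have := Real.cos_pos_of_mem_Ioo ⟨hΛ.1, hΛ.2⟩
    simp [exp_re]
    positivity
  obtain ⟨g, hg⟩ : ∃ g : ℝ → ℂ, g = fun s : ℝ => hyp m (-(s : ℂ)) * exp (-(4 * exp Λ * s)) :=
    ⟨_, rfl⟩
  have hfun : (fun t : ℝ => ((√π : ℝ) : ℂ)⁻¹ * hyp m (t * exp (direction u α * I) *
      (exp (α * I) / (4 * exp u))) * exp (-(exp ℓ * (t * exp (direction u α * I)))) *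
      exp (direction u α * I)) = fun t : ℝ => exp (direction u α * I) * ((√π : ℝ) : ℂ)⁻¹ *
        g (c * t) := by
    funext t
    rw [hg, mul_assoc (t : ℂ), exp_direction_mul, mul_left_comm (exp ℓ), hw, ← hc]
    have e1 : (t : ℂ) * -(c : ℂ) = -((c * t : ℝ) : ℂ) := by push_cast; ring
    have e2 : (t : ℂ) * (4 * exp Λ * c) = 4 * exp Λ * ((c * t : ℝ) : ℂ) := by push_cast; ring
    rw [e1, e2]
    ring
  have hint := integrableOn_laplace m hre
  rw [← hg] at hint
  simp only [hfun]
  constructor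
  · refine Integrable.const_mul ?_ _
    rw [← IntegrableOn, integrableOn_Ioi_comp_mul_left_iff _ _ hc0, mul_zero]
    exact hint
  · rw [integral_const_mul, integral_comp_mul_left_Ioi _ _ hc0, mul_zero]
    have hlap : ∫ s in Set.Ioi (0 : ℝ), g s = laplaceHyp m (4 * exp Λ) := by rw [hg, laplaceHyp]
    have hL := laplaceHyp_eq m hΛ
    have hp : (((√π : ℝ) : ℂ)) ^ 2 = π := by
      rw [← ofReal_pow, Real.sq_sqrt Real.pi_pos.le]
    have hp0 : ((√π : ℝ) : ℂ) ≠ 0 := ofReal_ne_zero.2 (Real.sqrt_pos.2 Real.pi_pos).ne'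
    have hc0' : (c : ℂ) ≠ 0 := ofReal_ne_zero.2 hc0.ne'
    rw [hlap, real_smul, ← mul_assoc, ← mul_assoc (exp ℓ), hw, ofReal_inv]
    have e : 4 * exp Λ * c * ((√π : ℝ) : ℂ)⁻¹ * ((c : ℂ)⁻¹ * laplaceHyp m (4 * exp Λ)) =
        ((√π : ℝ) : ℂ)⁻¹ * (4 * exp Λ * laplaceHyp m (4 * exp Λ)) := by
      field_simp
    rw [e, hL, ← hΛdef, resummed, ← hp]
    field_simp

theorem sPhi_eq (u : ℂ) (α : ℝ) (m : ℤ) (ℓ : ℂ) :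
    sPhi u α m ℓ = resummed m (ℓ + u - α * I - π * I) := by
  rw [sPhi, (isBorelSum_resummed u α m).borelSum_eq]

theorem isBorelSum_sPhi (u : ℂ) (α : ℝ) (m : ℤ) :
    IsBorelSum (phiCoeff u (exp (α * I)) m) (direction u α) (sPhi u α m) := by
  rw [funext (sPhi_eq u α m)]
  exact isBorelSum_resummed u α m

/-! ### The resummed weak functionals -/

theorem weakCotangent_ext {ξ ξ' : WeakCotangent} (hZ : ∀ m, ξ (eZ m) = ξ' (eZ m))
    (hV : ξ eV = ξ' eV) (hU : ξ eU = ξ' eU) : ξ = ξ' := by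
  have h1 : ∀ f : LaurentPolynomial ℂ, ξ (f, 0, 0) = ξ' (f, 0, 0) := by
    intro f
    induction f using LaurentPolynomial.induction_on' with
    | add f g hf hg =>
      have : ((f + g, 0, 0) : Test) = (f, 0, 0) + (g, 0, 0) := by simp
      rw [this, map_add, map_add, hf, hg]
    | C_mul_T n a =>
      have : ((LaurentPolynomial.C a * LaurentPolynomial.T n, 0, 0) : Test) = a • eZ n := by
        simp [eZ, LaurentPolynomial.smul_eq_C_mul]
      rw [this, map_smul, map_smul, hZ]
  refine LinearMap.ext fun ⟨f, a, b⟩ => ?_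
  have : ((f, a, b) : Test) = (f, 0, 0) + a • eV + b • eU := by simp [eV, eU]
  rw [this, map_add, map_add, map_add, map_add, map_smul, map_smul, map_smul, map_smul, h1, hV, hU]

theorem weakOfCoeffs_eZ (C : ℤ → ℂ) (Cv Cu : ℂ) (m : ℤ) :
    weakOfCoeffs C Cv Cu (eZ m) = C m := by
  have : Finsupp.linearCombination ℂ C (LaurentPolynomial.T m : LaurentPolynomial ℂ).coeff =
      C m := by
    change Finsupp.linearCombination ℂ C (Finsupp.single m 1) = C m
    simp
  simpa [weakOfCoeffs, eZ] using this

theorem weakOfCoeffs_eV (C : ℤ → ℂ) (Cv Cu : ℂ) : weakOfCoeffs C Cv Cu eV = Cv := by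
  simp [weakOfCoeffs, eV]

theorem weakOfCoeffs_eU (C : ℤ → ℂ) (Cv Cu : ℂ) : weakOfCoeffs C Cv Cu eU = Cu := by
  simp [weakOfCoeffs, eU]

/-- With `Λ = ℓ + u - iα - iπ` one has `ζ u_p = ζ v - 2 e^Λ`, which cancels the factor `exp (2 e^Λ)`
of `resummed`, and `√(p/eᵘ) e^{Λ/2} = -i ζ^{1/2}`. -/
theorem resummed_coefficient (v u : ℂ) (α : ℝ) (ℓ : ℂ) (m : ℤ) :
    exp (exp ℓ * lamSigma (sigmaAt (specialPoint v u) (exp (α * I))) (specialPoint v u)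
      (exp (α * I))) * (1 / 2) * exp ((α * I - u) / 2) * sPhi u α m ℓ =
      -(I / π) * exp (ℓ / 2) * exp (exp ℓ * v) * macK m (ℓ + u - α * I - π * I) := by
  have hp := exp_ne_zero (α * I : ℂ)
  have h1 : exp ℓ * lamSigma (sigmaAt (specialPoint v u) (exp (α * I))) (specialPoint v u)
      (exp (α * I)) = exp ℓ * v + -(2 * exp (ℓ + u - α * I - π * I)) := by
    rw [lamSigma_specialPoint, sigmaAt_specialPoint v u hp, exp_sub _ (π * I : ℂ), exp_pi_mul_I,
      exp_sub, exp_add]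
    field_simp
    ring
  have h2 : exp ((α * I - u) / 2) * exp ((ℓ + u - α * I - π * I) / 2) = -I * exp (ℓ / 2) := by
    rw [← exp_add, show (α * I - u) / 2 + (ℓ + u - α * I - π * I) / 2 =
      -(π / 2 * I) + ℓ / 2 by ring, exp_add, exp_neg, exp_pi_div_two_mul_I]
    simp
  have h3 := exp_add (-(2 * exp (ℓ + u - α * I - π * I))) (2 * exp (ℓ + u - α * I - π * I))
  rw [neg_add_cancel, exp_zero] at h3
  rw [h1, sPhi_eq, resummed, exp_add]
  generalize macK m (ℓ + u - α * I - π * I) = K at *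
  generalize exp (2 * exp (ℓ + u - α * I - π * I)) = X at *
  generalize exp (-(2 * exp (ℓ + u - α * I - π * I))) = Y at *
  linear_combination exp (exp ℓ * v) * K / π * (Y * X * h2 + I * exp (ℓ / 2) * h3)

theorem ds_eZ (v u : ℂ) (α : ℝ) (ℓ : ℂ) (m : ℤ) : ds v u α ℓ (eZ m) =
    (if 1 ≤ m then 1 + exp u / exp (α * I) ^ 2 else 1 + exp u / exp (α * I) ^ 2 - 1) *
      exp (α * I) ^ m *
      (-(I / π) * exp (ℓ / 2) * exp (exp ℓ * v) * macK m (ℓ + u - α * I - π * I)) := by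
  rw [← resummed_coefficient, ds, weakOfCoeffs_eZ, ← sigmaAt_specialPoint v u (exp_ne_zero _)]
  ring

theorem ds_eV (v u : ℂ) (α : ℝ) (ℓ : ℂ) : ds v u α ℓ eV =
    -(I / π) * exp (ℓ / 2) * exp (exp ℓ * v) * macK 0 (ℓ + u - α * I - π * I) := by
  rw [← resummed_coefficient, ds, weakOfCoeffs_eV]

theorem ds_eU (v u : ℂ) (α : ℝ) (ℓ : ℂ) : ds v u α ℓ eU = exp u / exp (α * I) *
    (-(I / π) * exp (ℓ / 2) * exp (exp ℓ * v) * macK (-1) (ℓ + u - α * I - π * I)) := by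
  have hr : (exp ((α * I - u) / 2))⁻¹ = exp u / exp (α * I) * exp ((α * I - u) / 2) := by
    rw [← exp_sub, ← exp_add, ← exp_neg]
    ring_nf
  rw [← resummed_coefficient, ds, weakOfCoeffs_eU, hr]
  ring

theorem exp_sub_pi_mul_I (α : ℝ) : exp (((α - π : ℝ) : ℂ) * I) = -exp (α * I) := by
  rw [ofReal_sub, sub_mul, exp_sub, exp_pi_mul_I, div_neg, div_one]

/-- For `-p` the argument of `macK` is larger by `π i`, while `σ(-p) = σ(p)`. The sign of `(-p)^m`,
or of `eᵘ/(-p)` for `e_u`, matches `e^{m π i}` in the monodromy formula. So the `K`-terms cancel and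
`-(i/π) · π i = 1` leaves the Bessel function `I`. -/
theorem dy_comp_testIncl (v u : ℂ) (α : ℝ) (ℓ : ℂ) :
    dy (1 + exp u / exp (α * I) ^ 2) ℓ (specialPoint v u) ∘ₗ testIncl =
      ds v u α ℓ - ds v u (α - π) ℓ := by
  have hp := exp_ne_zero (α * I : ℂ)
  have hpi : (π : ℂ) ≠ 0 := ofReal_ne_zero.2 Real.pi_ne_zero
  have hL : ℓ + u - ((α - π : ℝ) : ℂ) * I - π * I = ℓ + u - α * I := by
    push_cast
    ring
  have hx : exp ℓ * (2 * exp u / exp (α * I)) = 2 * exp (ℓ + u - α * I) := by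
    rw [exp_sub, exp_add]
    ring
  have hIpi : I / π * (π * I) = -1 := by
    rw [← mul_assoc, div_mul_cancel₀ _ hpi, I_mul_I]
  refine weakCotangent_ext (fun m => ?_) ?_ ?_
  · have hsgn : (-exp (α * I)) ^ m = exp (α * I) ^ m * exp (m * (π * I)) := by
      rw [exp_int_mul, exp_pi_mul_I, ← mul_zpow, mul_neg_one]
    rw [LinearMap.comp_apply, LinearMap.sub_apply, dy_eZ v u ℓ hp, ds_eZ, ds_eZ, hL,
      exp_sub_pi_mul_I, neg_sq, hsgn, macK_sub_pi_I, hx]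
    linear_combination (if 1 ≤ m then 1 + exp u / exp (α * I) ^ 2 else
      1 + exp u / exp (α * I) ^ 2 - 1) * exp (α * I) ^ m * exp (ℓ / 2) * exp (exp ℓ * v) *
      besselI m (2 * exp (ℓ + u - α * I)) * hIpi
  · rw [LinearMap.comp_apply, LinearMap.sub_apply, dy_eV v u ℓ hp, ds_eV, ds_eV, hL,
      macK_sub_pi_I, hx, Int.cast_zero, zero_mul, exp_zero]
    linear_combination exp (ℓ / 2) * exp (exp ℓ * v) *
      besselI 0 (2 * exp (ℓ + u - α * I)) * hIpi
  · have h1 : exp (((-1 : ℤ) : ℂ) * (π * I)) = -1 := by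
      rw [Int.cast_neg, Int.cast_one, neg_one_mul, exp_neg, exp_pi_mul_I]
      norm_num
    rw [LinearMap.comp_apply, LinearMap.sub_apply, dy_eU v u ℓ hp, ds_eU, ds_eU, hL,
      exp_sub_pi_mul_I, macK_sub_pi_I, hx, h1, besselI_neg_one, div_neg]
    linear_combination (exp u / exp (α * I)) * exp (ℓ / 2) * exp (exp ℓ * v) *
      besselI 1 (2 * exp (ℓ + u - α * I)) * hIpi

end TodaDF

end

/-! ### The proposition at the special point. -/

theorem mainTheorem9 (v u : ℂ) (α : ℝ) (ℓ : ℂ) (P : TodaDF.Point)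
    (hP : P = TodaDF.specialPoint v u) (p ζ σ : ℂ) (hp : p = Complex.exp (α * Complex.I))
    (hζ : ζ = Complex.exp ℓ) (hσ : σ = TodaDF.sigmaAt P p) :
    -- `dy_σ(ζ)` is the differential of the functional `y_σ(ζ)`
    (∀ X : TodaDF.Tangent,
      HasDerivAt (fun t : ℂ => TodaDF.yInt σ ℓ (P + t • X)) (TodaDF.dy σ ℓ P X) 0) ∧
    -- its coefficients are modified Bessel functions of the first kind
    (∀ m : ℤ, 1 ≤ m → TodaDF.dy σ ℓ P (TodaDF.testIncl (TodaDF.eZ m)) =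
      (Complex.exp u / p ^ 2 + 1) * Complex.exp (ℓ / 2) * Complex.exp (ζ * v) * p ^ m *
        TodaDF.besselI m (ζ * (2 * Complex.exp u / p))) ∧
    (∀ m : ℤ, m ≤ 0 → TodaDF.dy σ ℓ P (TodaDF.testIncl (TodaDF.eZ m)) =
      Complex.exp u / p ^ 2 * Complex.exp (ℓ / 2) * Complex.exp (ζ * v) * p ^ m *
        TodaDF.besselI m (ζ * (2 * Complex.exp u / p))) ∧
    TodaDF.dy σ ℓ P (TodaDF.testIncl TodaDF.eV) =
      Complex.exp (ℓ / 2) * Complex.exp (ζ * v) *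
        TodaDF.besselI 0 (ζ * (2 * Complex.exp u / p)) ∧
    TodaDF.dy σ ℓ P (TodaDF.testIncl TodaDF.eU) =
      Complex.exp u / p * Complex.exp (ℓ / 2) * Complex.exp (ζ * v) *
        TodaDF.besselI 1 (ζ * (2 * Complex.exp u / p)) ∧
    -- the formal series defining `ds_p` and `ds_{-p}` are Borel resummable
    (∀ m : ℤ, TodaDF.IsBorelSum (TodaDF.phiCoeff u p m) (TodaDF.direction u α)
        (TodaDF.sPhi u α m) ∧
      TodaDF.IsBorelSum (TodaDF.phiCoeff u (-p) m) (TodaDF.direction u (α - π))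
        (TodaDF.sPhi u (α - π) m)) ∧
    -- `dy_σ(ζ) = ds_p(ζ) - ds_{-p}(ζ)`, where `-p = exp (i (α - π))`
    TodaDF.dy σ ℓ P ∘ₗ TodaDF.testIncl = TodaDF.ds v u α ℓ - TodaDF.ds v u (α - π) ℓ ∧
    -- the common value is a representable cotangent vector
    TodaDF.IsRepresentable P (TodaDF.dy σ ℓ P) := by
  subst hP hζ hσ
  have hp0 : p ≠ 0 := hp ▸ Complex.exp_ne_zero _
  rw [TodaDF.sigmaAt_specialPoint v u hp0]
  refine ⟨TodaDF.hasDerivAt_yInt _ ℓ _, fun m hm => ?_, fun m hm => ?_,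
    TodaDF.dy_eV v u ℓ hp0, TodaDF.dy_eU v u ℓ hp0, fun m => ⟨?_, ?_⟩, ?_,
    TodaDF.isRepresentable_dy _ ℓ v u⟩
  · rw [TodaDF.dy_eZ v u ℓ hp0, if_pos hm, add_comm (1 : ℂ)]
  · rw [TodaDF.dy_eZ v u ℓ hp0, if_neg (by omega), add_sub_cancel_left]
  · rw [hp]
    exact TodaDF.isBorelSum_sPhi u α m
  · rw [hp, ← TodaDF.exp_sub_pi_mul_I]
    exact TodaDF.isBorelSum_sPhi u (α - π) m
  · rw [hp]
    exact TodaDF.dy_comp_testIncl v u α ℓ
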